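/- Let $S$ be a monoid, $G$ a group with identity $e$, and $\sigma\colon S\curvearrowright G$ an algebraic action, i.e. a monoid homomorphism $s\mapsto\sigma_s$ from $S$ to $\mathrm{End}(G)$ with every $\sigma_s$ injective. Assume that $\sigma$ is faithful ($s\mapsto\sigma_s$ is injective) and non-automorphic (some $\sigma_s$ is not surjective). Let $I$ be the inverse semigroup of partial bijections of $G$ generated by the $\sigma_s$ ($s\in S$) and the left translations $\mathbb{t}_g$ ($g\in G$). Let $\mathcal C$ (the constructible subgroups) be the smallest family of subgroups of $G$ that contains $G$ and is closed under $C\mapsto\sigma_s(C)$ and $C\mapsto\sigma_s^{-1}(C)$ for all $s \in S$. Let $\mathcal E$ be the semilattice of idempotents of $I$, identified with their domains, so that $\mathcal E=\{gC : g\in G,\,C\in\mathcal C\}\cup\{\emptyset\}$. Let $\widehat{\mathcal E}$ be the space of nonzero multiplicative maps $\chi\colon\mathcal E\to\{0,1\}$ with $\chi(\emptyset)=0$, with the topology of pointwise convergence, and let $\partial\widehat{\mathcal E}$ be the closure of the set of those $\chi$ for which the filter $\{A\in\mathcal E:\chi(A)=1\}$ is maximal under inclusion. If $\phi\in I$ and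 $\chi(\mathrm{dom}\,\phi)=1$, put $(\phi.\chi)(A)=\chi(\phi^{-1}(A\cap\mathrm{im}\,\phi))$. A set $\mathfrak X\subseteq\widehat{\mathcal E}$ is invariant if $\phi.\chi\in\mathfrak X$ whenever $\chi\in\mathfrak X$, $\phi\in I$ and $\chi(\mathrm{dom}\,\phi)=1$. Let $I\ltimes\widehat{\mathcal E}$ be the groupoid of germs $[\phi,\chi]$ ($\phi\in I$, $\chi\in\widehat{\mathcal E}$, $\chi(\mathrm{dom}\,\phi)=1$), where $[\phi,\chi]=[\psi,\omega]$ if and only if $\chi=\omega$ and $\phi|_A=\psi|_A$ for some $A\in\mathcal E$ with $\chi(A)=1$. It has source $\chi$, range $\phi.\chi$, product $[\phi,\psi.\chi][\psi,\chi]=[\phi\psi,\chi]$, inverse $[\phi,\chi]^{-1}=[\phi^{-1},\phi.\chi]$, and the topology with basis the sets $\{[\phi,\chi]:\chi\in V\}$, where $\phi \in I$ and $V=\{\chi:\chi(A)=1,\ \chi(B)=0\ \forall B\in\mathfrak f\}$ with $A\in\mathcal E$, $\mathfrak f\subseteq\mathcal E$ finite, and $\chi(\mathrm{dom}\,\phi)=1$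 for all $\chi\in V$. For an invariant set $\mathfrak X$ let $I\ltimes\mathfrak X$ be its restriction to $\mathfrak X$, and put $\mathcal G_\sigma=I\ltimes\partial\widehat{\mathcal E}$. An étale groupoid $\mathcal G$ is topologically free if for every open bisection $U\subseteq\mathcal G$ that consists of non-unit elements with equal source and range, the set $\{x\in\mathcal G^{(0)} : \mathcal G_x^x\cap U\neq\emptyset\}$ has empty interior in $\mathcal G^{(0)}$. For $\chi\in\widehat{\mathcal E}$ let $\mathfrak F(\chi)=\{C\in\mathcal C : \chi(gC)=1\text{ for some }g\in G\}$. For a set $\mathfrak F$ of subgroups put $\cap\mathfrak F=\bigcap_{C\in\mathfrak F}C$, and for a subgroup $H$ of $G$ put $\mathrm{core}_G(H)=\bigcap_{g\in G}gHg^{-1}$. **Theorem.** Let $\mathfrak X\subseteq\partial\widehat{\mathcal E}$ be closed and invariant, and let $\boldsymbol{\mathfrak F}=\{\mathfrak F(\chi):\chi\in\mathfrak X\}$. (i) If $I\ltimes\mathfrak X$ is topologically free, then for all $D\in\bigcup_{\mathfrak F\in\boldsymbol{\mathfrak F}}\mathfrak F$ we have $\bigcap_{\mathfrak F\in\boldsymbol{\mathfrak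 F},\,D\in\mathfrak F}\mathrm{core}_G(\cap\mathfrak F)=\{e\}$. (ii) If for all $D\in\bigcup_{\mathfrak F\in\boldsymbol{\mathfrak F}}\mathfrak F$ we have $\bigcap_{\mathfrak F\in\boldsymbol{\mathfrak F},\,D\in\mathfrak F}\cap\mathfrak F=\{e\}$, then $I\ltimes\mathfrak X$ is topologically free. In particular, if $G$ is abelian, then $\mathcal G_\sigma$ is topologically free if and only if $\sigma$ is exact, i.e. $\bigcap_{C\in\mathcal C}C=\{e\}$. -/

import Mathlib

open Set Topology
open scoped Pointwise

namespace AlgAct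

universe u v

/-- An algebraic action of the monoid `S` on the group `G`: an action by injective group
endomorphisms. -/
structure AlgebraicAction (S : Type u) (G : Type v) [Monoid S] [Group G] where
  hom : S →* Monoid.End G
  injective : ∀ s : S, Function.Injective (hom s)

/-- A partial bijection `φ` of `G` is an element of `G ≃. G`, with `b ∈ φ a` meaning `φ(a) = b`.
The composite `φψ` (first `ψ`, then `φ`) is `ψ.trans φ`. -/
def dom {G : Type v} (φ : G ≃. G) : Set G := {a | ∃ b, b ∈ φ a}

/-- The set `φ⁻¹(A ∩ im φ)`. -/
def preim {G : Type v} (φ : G ≃. G) (A : Set G) : Set G := {a | ∃ b, b ∈ φ a ∧ b ∈ A}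

section Action

variable {S : Type u} {G : Type v} [Monoid S] [Group G] (σ : AlgebraicAction S G)

/-- `σ` is injective as a homomorphism into the endomorphisms of `G`. -/
def AlgebraicAction.Faithful : Prop := Function.Injective σ.hom

/-- Not all `σ_s` are automorphisms. -/
def AlgebraicAction.NonAutomorphic : Prop := ∃ s : S, ¬ Function.Surjective (σ.hom s)

open Classical in
/-- `σ_s` as a partial bijection of `G`, with domain `G` and image `σ_s G`. -/
noncomputable def sigmaP (s : S) : G ≃. G where
  toFun g := some (σ.hom s g)
  invFun := Function.partialInv (σ.hom s)
  inv a b := by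
    have h := (σ.injective s).isPartialInv a b
    simp only [Option.some.injEq] at h ⊢
    exact h

/-- Left translation `t_g` as a partial bijection of `G`. -/
def translP (g : G) : G ≃. G := (Equiv.mulLeft g).toPEquiv

/-- Membership in the inverse semigroup `I` of partial bijections of `G` generated by the
`σ_s` and the translations. -/
inductive MemI : (G ≃. G) → Prop
  | sigma (s : S) : MemI (sigmaP σ s)
  | transl (g : G) : MemI (translP g)
  | inv {φ : G ≃. G} : MemI φ → MemI φ.symm
  | comp {φ ψ : G ≃. G} : MemI φ → MemI ψ → MemI (ψ.trans φ)

/-- The family `𝒞` of `S`-constructible subgroups of `G`. -/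
inductive IsConstructible : Subgroup G → Prop
  | top : IsConstructible ⊤
  | map (s : S) {C : Subgroup G} : IsConstructible C → IsConstructible (C.map (σ.hom s))
  | comap (s : S) {C : Subgroup G} : IsConstructible C → IsConstructible (C.comap (σ.hom s))

/-- `σ` is exact: the constructible subgroups intersect trivially. -/
def AlgebraicAction.Exact : Prop := sInf {C : Subgroup G | IsConstructible σ C} = ⊥

/-- The semilattice `ℰ` of idempotents of `I`, each idempotent being identified with the subset
of `G` on which it is the identity, that is, with its domain. -/
def cosets : Set (Set G) := {A | ∃ ε : G ≃. G, MemI σ ε ∧ ε.trans ε = ε ∧ dom ε = A}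

theorem eq_of_idem {G : Type v} {ε : G ≃. G} (h : ε.trans ε = ε) {a b : G} (hb : b ∈ ε a) : b = a := by
  have h1 : b ∈ (ε.trans ε) a := by rw [h]; exact hb
  rw [PEquiv.mem_trans] at h1
  obtain ⟨c, hc, hc'⟩ := h1
  have : c = b := Option.mem_unique hc hb
  subst this
  exact (ε.inj hc hc').symm

theorem idem_of_forall {G : Type v} {ε : G ≃. G} (h : ∀ a b, b ∈ ε a → b = a) : ε.trans ε = ε := by
  ext a b
  change b ∈ (ε.trans ε) a ↔ b ∈ ε a
  rw [PEquiv.mem_trans]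
  constructor
  · rintro ⟨c, hc, hb⟩
    rw [h _ _ hc] at hb
    exact hb
  · intro hb
    have := h _ _ hb
    subst this
    exact ⟨b, hb, hb⟩

theorem inter_mem_cosets {A B : Set G} (hA : A ∈ cosets σ) (hB : B ∈ cosets σ) :
    A ∩ B ∈ cosets σ := by
  obtain ⟨ε, hε, iε, rfl⟩ := hA
  obtain ⟨δ, hδ, iδ, rfl⟩ := hB
  refine ⟨δ.trans ε, MemI.comp hε hδ, ?_, ?_⟩
  · apply idem_of_forall
    intro a b hb
    rw [PEquiv.mem_trans] at hb
    obtain ⟨c, hc, hb⟩ := hb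
    rw [eq_of_idem iε hb, eq_of_idem iδ hc]
  · ext a
    simp only [dom, mem_ofPred_eq, mem_inter_iff, PEquiv.mem_trans]
    constructor
    · rintro ⟨b, c, hc, hb⟩
      refine ⟨⟨b, ?_⟩, ⟨c, hc⟩⟩
      rw [← eq_of_idem iδ hc]; exact hb
    · rintro ⟨⟨b, hb⟩, ⟨c, hc⟩⟩
      refine ⟨b, c, hc, ?_⟩
      rw [eq_of_idem iδ hc]; exact hb

theorem preim_mem_cosets {φ : G ≃. G} (hφ : MemI σ φ) {A : Set G} (hA : A ∈ cosets σ) :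
    preim φ A ∈ cosets σ := by
  obtain ⟨ε, hε, iε, rfl⟩ := hA
  refine ⟨φ.trans (ε.trans φ.symm), MemI.comp (MemI.comp (MemI.inv hφ) hε) hφ, ?_, ?_⟩
  · apply idem_of_forall
    intro a b hb
    simp only [PEquiv.mem_trans, PEquiv.mem_iff_mem] at hb
    obtain ⟨c, hc, d, hd, hb⟩ := hb
    rw [eq_of_idem iε hd] at hb
    exact φ.inj hb hc
  · ext a
    simp only [dom, preim, mem_ofPred_eq, PEquiv.mem_trans, PEquiv.mem_iff_mem]
    constructor
    · rintro ⟨b, c, hc, d, hd, hb⟩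
      exact ⟨c, hc, d, hd⟩
    · rintro ⟨c, hc, d, hd⟩
      have := eq_of_idem iε hd
      subst this
      exact ⟨a, d, hc, d, hd, hc⟩

theorem dom_mem_cosets {φ : G ≃. G} (hφ : MemI σ φ) : dom φ ∈ cosets σ := by
  refine ⟨φ.trans φ.symm, MemI.comp (MemI.inv hφ) hφ, ?_, ?_⟩
  · apply idem_of_forall
    intro a b hb
    simp only [PEquiv.mem_trans, PEquiv.mem_iff_mem] at hb
    obtain ⟨c, hc, hb⟩ := hb
    exact φ.inj hb hc
  · ext a
    simp only [dom, mem_ofPred_eq, PEquiv.mem_trans, PEquiv.mem_iff_mem]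
    exact ⟨fun ⟨_, c, hc, _⟩ => ⟨c, hc⟩, fun ⟨c, hc⟩ => ⟨a, c, hc, hc⟩⟩

/-- The inverse semigroup `I`. -/
abbrev SemI : Type v := {φ : G ≃. G // MemI σ φ}

/-- The semilattice `ℰ` as a type. -/
abbrev Cos : Type v := {A : Set G // A ∈ cosets σ}

variable {σ}

def Cos.inter (A B : Cos σ) : Cos σ := ⟨A.1 ∩ B.1, inter_mem_cosets σ A.2 B.2⟩

/-- `dom φ` as an element of `ℰ`. -/
def SemI.dom (φ : SemI σ) : Cos σ := ⟨AlgAct.dom φ.1, dom_mem_cosets σ φ.2⟩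

/-- `φ⁻¹(A ∩ im φ)` as an element of `ℰ`. -/
def SemI.preim (φ : SemI σ) (A : Cos σ) : Cos σ :=
  ⟨AlgAct.preim φ.1 A.1, preim_mem_cosets σ φ.2 A.2⟩

/-- The product `φψ` in `I`: first `ψ`, then `φ`. -/
def SemI.mul (φ ψ : SemI σ) : SemI σ := ⟨ψ.1.trans φ.1, MemI.comp φ.2 ψ.2⟩

def SemI.inv (φ : SemI σ) : SemI σ := ⟨φ.1.symm, MemI.inv φ.2⟩

variable (σ) in
/-- The identity of `G` as an element of `I`. -/
def SemI.one : SemI σ := ⟨translP 1, MemI.transl 1⟩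

theorem SemI.mem_one {a b : G} : b ∈ (SemI.one σ).1 a ↔ b = a := by
  simp [SemI.one, translP, Equiv.toPEquiv_apply, eq_comm]

variable (σ) in
/-- The character space of `ℰ`: nonzero multiplicative maps to `{0,1}` which send `∅` to `0`.
Its topology is the subspace topology of the product topology on `Cos σ → Bool`, that is, the
topology of pointwise convergence. -/
abbrev Char : Type v :=
  {χ : Cos σ → Bool // (∃ A, χ A = true) ∧ (∀ A B, χ (A.inter B) = (χ A && χ B)) ∧
    ∀ A : Cos σ, A.1 = ∅ → χ A = false}

theorem Char.inter_iff (χ : Char σ) (A B : Cos σ) :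
    χ.1 (A.inter B) = true ↔ χ.1 A = true ∧ χ.1 B = true := by
  rw [χ.2.2.1, Bool.and_eq_true]

theorem Char.mono (χ : Char σ) {A B : Cos σ} (h : A.1 ⊆ B.1) (hA : χ.1 A = true) :
    χ.1 B = true := by
  have : A.inter B = A := Subtype.ext (inter_eq_left.2 h)
  rw [← this, χ.inter_iff] at hA
  exact hA.2

/-- Two elements of `ℰ` which agree inside a third one on which `χ` is `1` have the same value. -/
theorem Char.congr (χ : Char σ) {A B C : Cos σ} (hC : χ.1 C = true)
    (h : A.1 ∩ C.1 = B.1 ∩ C.1) : χ.1 A = χ.1 B := by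
  have : A.inter C = B.inter C := Subtype.ext h
  have h2 := congrArg χ.1 this
  rw [χ.2.2.1, χ.2.2.1, hC, Bool.and_true, Bool.and_true] at h2
  exact h2

/-- The filter of elements of `ℰ` on which `χ` is `1`. -/
def Char.filt (χ : Char σ) : Set (Cos σ) := {A | χ.1 A = true}

variable (σ) in
/-- Characters whose filter is maximal. -/
def maxChars : Set (Char σ) := {χ | ∀ ω : Char σ, χ.filt ⊆ ω.filt → χ.filt = ω.filt}

variable (σ) in
/-- The boundary `∂Ê`. -/
def boundary : Set (Char σ) := closure (maxChars σ)

/-- For `χ(dom φ) = 1`, the character `φ.χ`, given by `(φ.χ)(A) = χ(φ⁻¹(A ∩ im φ))`. -/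
def Char.act (φ : SemI σ) (χ : Char σ) (h : χ.1 φ.dom = true) : Char σ :=
  ⟨fun A => χ.1 (φ.preim A), by
    refine ⟨⟨φ.inv.dom, ?_⟩, ?_, ?_⟩
    · refine χ.mono (A := φ.dom) ?_ h
      rintro a ⟨b, hb⟩
      exact ⟨b, hb, a, (PEquiv.mem_iff_mem φ.1).2 hb⟩
    · intro A B
      rw [← χ.2.2.1]
      refine congrArg χ.1 (Subtype.ext ?_)
      ext a
      constructor
      · rintro ⟨b, hb, hA, hB⟩
        exact ⟨⟨b, hb, hA⟩, ⟨b, hb, hB⟩⟩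
      · rintro ⟨⟨b, hb, hA⟩, ⟨c, hc, hB⟩⟩
        have := Option.mem_unique hb hc
        subst this
        exact ⟨b, hb, hA, hB⟩
    · intro A hA
      apply χ.2.2.2
      ext a
      simp [SemI.preim, AlgAct.preim, hA]⟩

/-- Invariance of a set of characters under the partial action of `I`. -/
def Invariant (X : Set (Char σ)) : Prop :=
  ∀ (φ : SemI σ) (χ : Char σ) (h : χ.1 φ.dom = true), χ ∈ X → χ.act φ h ∈ X

/-- The filter `𝔉(χ)` on `𝒞`: all `C ∈ 𝒞` such that `χ(gC) = 1` for some `g ∈ G`. -/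
def Char.subgroupFilter (χ : Char σ) : Set (Subgroup G) :=
  {C | IsConstructible σ C ∧ ∃ (g : G) (A : Cos σ), A.1 = g • (C : Set G) ∧ χ.1 A = true}

/-- `𝔉(𝔛) = {𝔉(χ) : χ ∈ 𝔛}`. -/
def filterFamily (X : Set (Char σ)) : Set (Set (Subgroup G)) := Char.subgroupFilter '' X

end Action

/-- A groupoid with unit space `X` and a topology on its arrows. The product `mul a b` is defined
when the source of `a` is the range of `b`. -/
structure TopGroupoid (X : Type v) where
  Arrow : Type v
  top : TopologicalSpace Arrow
  src : Arrow → X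
  rng : Arrow → X
  unit : X → Arrow
  inv : Arrow → Arrow
  mul : (a b : Arrow) → src a = rng b → Arrow
  src_unit : ∀ x, src (unit x) = x
  rng_unit : ∀ x, rng (unit x) = x
  src_inv : ∀ a, src (inv a) = rng a
  rng_inv : ∀ a, rng (inv a) = src a
  src_mul : ∀ a b h, src (mul a b h) = src b
  rng_mul : ∀ a b h, rng (mul a b h) = rng a
  mul_assoc : ∀ a b c (h : src a = rng b) (k : src b = rng c),
    mul (mul a b h) c ((src_mul a b h).trans k) = mul a (mul b c k) (h.trans (rng_mul b c k).symm)
  unit_mul : ∀ a, mul (unit (rng a)) a (src_unit _) = a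
  mul_unit : ∀ a, mul a (unit (src a)) (rng_unit _).symm = a
  inv_mul : ∀ a, mul (inv a) a (src_inv a) = unit (src a)
  mul_inv : ∀ a, mul a (inv a) (rng_inv a).symm = unit (rng a)

attribute [instance] TopGroupoid.top

namespace TopGroupoid

/-- The restriction of a groupoid to a set `Y` of units, with the subspace topology. -/
def restrict {X : Type v} (𝒢 : TopGroupoid X) (Y : Set X) : TopGroupoid Y where
  Arrow := {a : 𝒢.Arrow // 𝒢.src a ∈ Y ∧ 𝒢.rng a ∈ Y}
  top := inferInstance
  src a := ⟨𝒢.src a.1, a.2.1⟩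
  rng a := ⟨𝒢.rng a.1, a.2.2⟩
  unit x := ⟨𝒢.unit x.1, by rw [𝒢.src_unit]; exact x.2, by rw [𝒢.rng_unit]; exact x.2⟩
  inv a := ⟨𝒢.inv a.1, by rw [𝒢.src_inv]; exact a.2.2, by rw [𝒢.rng_inv]; exact a.2.1⟩
  mul a b h := ⟨𝒢.mul a.1 b.1 (congrArg Subtype.val h), by rw [𝒢.src_mul]; exact b.2.1,
    by rw [𝒢.rng_mul]; exact a.2.2⟩
  src_unit x := Subtype.ext (𝒢.src_unit _)
  rng_unit x := Subtype.ext (𝒢.rng_unit _)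
  src_inv a := Subtype.ext (𝒢.src_inv _)
  rng_inv a := Subtype.ext (𝒢.rng_inv _)
  src_mul a b h := Subtype.ext (𝒢.src_mul _ _ _)
  rng_mul a b h := Subtype.ext (𝒢.rng_mul _ _ _)
  mul_assoc a b c h k := Subtype.ext
    (𝒢.mul_assoc a.1 b.1 c.1 (congrArg Subtype.val h) (congrArg Subtype.val k))
  unit_mul a := Subtype.ext (𝒢.unit_mul _)
  mul_unit a := Subtype.ext (𝒢.mul_unit _)
  inv_mul a := Subtype.ext (𝒢.inv_mul _)
  mul_inv a := Subtype.ext (𝒢.mul_inv _)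

/-- The isotropy bundle: the arrows with equal source and range. -/
def iso {X : Type v} (𝒢 : TopGroupoid X) : Set 𝒢.Arrow := {a | 𝒢.src a = 𝒢.rng a}

/-- An open set of arrows on which source and range are injective. -/
def IsOpenBisection {X : Type v} (𝒢 : TopGroupoid X) (U : Set 𝒢.Arrow) : Prop :=
  IsOpen U ∧ InjOn 𝒢.src U ∧ InjOn 𝒢.rng U

/-- Topological freeness: if an open bisection `U` consists of non-unit isotropy arrows, then the
set of units `x` whose isotropy group meets `U` has empty interior in the unit space. -/
def TopologicallyFree {X : Type v} [TopologicalSpace X] (𝒢 : TopGroupoid X) : Prop :=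
  ∀ U : Set 𝒢.Arrow, 𝒢.IsOpenBisection U → U ⊆ 𝒢.iso \ range 𝒢.unit →
    interior {x : X | ∃ a ∈ U, 𝒢.src a = x ∧ 𝒢.rng a = x} = ∅

end TopGroupoid

section Germs

variable {S : Type u} {G : Type v} [Monoid S] [Group G] (σ : AlgebraicAction S G)

/-- The pairs `(φ, χ)` with `χ(dom φ) = 1`. -/
abbrev PreGerm : Type v := {p : SemI σ × Char σ // p.2.1 p.1.dom = true}

variable {σ}

/-- `(φ, χ) ∼ (ψ, ω)` iff `χ = ω` and `φ`, `ψ` have the same restriction to some `A ∈ ℰ` with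
`χ(A) = 1` (so `A ≠ ∅`). -/
def PreGerm.Rel (p q : PreGerm σ) : Prop :=
  p.1.2 = q.1.2 ∧ ∃ A : Cos σ, p.1.2.1 A = true ∧ ∀ a ∈ A.1, p.1.1.1 a = q.1.1.1 a

instance PreGerm.setoid : Setoid (PreGerm σ) where
  r := PreGerm.Rel
  iseqv := by
    refine ⟨fun p => ⟨rfl, p.1.1.dom, p.2, fun _ _ => rfl⟩, ?_, ?_⟩
    · rintro p q ⟨h, A, hA, hA'⟩
      exact ⟨h.symm, A, h ▸ hA, fun a ha => (hA' a ha).symm⟩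
    · rintro p q r ⟨h, A, hA, hA'⟩ ⟨k, B, hB, hB'⟩
      refine ⟨h.trans k, A.inter B, ?_, fun a ha => (hA' a ha.1).trans (hB' a ha.2)⟩
      rw [Char.inter_iff]
      exact ⟨hA, h ▸ hB⟩

variable (σ) in
/-- The germs `[φ, χ]`. -/
def Germ : Type v := Quotient (PreGerm.setoid (σ := σ))

/-- The germ `[φ, χ]`. -/
def Germ.mk (φ : SemI σ) (χ : Char σ) (h : χ.1 φ.dom = true) : Germ σ :=
  Quotient.mk _ (⟨(φ, χ), h⟩ : PreGerm σ)

theorem Germ.mk_eq {φ ψ : SemI σ} {χ ω : Char σ} {h : χ.1 φ.dom = true} {k : ω.1 ψ.dom = true}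
    (e : χ = ω) (A : Cos σ) (hA : χ.1 A = true) (hA' : ∀ a ∈ A.1, φ.1 a = ψ.1 a) :
    Germ.mk φ χ h = Germ.mk ψ ω k :=
  Quotient.sound (s := PreGerm.setoid) (a := ⟨(φ, χ), h⟩) (b := ⟨(ψ, ω), k⟩) ⟨e, A, hA, hA'⟩

theorem Germ.exact {φ ψ : SemI σ} {χ ω : Char σ} {h : χ.1 φ.dom = true} {k : ω.1 ψ.dom = true}
    (e : Germ.mk φ χ h = Germ.mk ψ ω k) :
    χ = ω ∧ ∃ A : Cos σ, χ.1 A = true ∧ ∀ a ∈ A.1, φ.1 a = ψ.1 a :=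
  Quotient.exact (s := PreGerm.setoid) e

theorem Germ.exists_rep (a : Germ σ) :
    ∃ (φ : SemI σ) (χ : Char σ) (h : χ.1 φ.dom = true), a = Germ.mk φ χ h := by
  obtain ⟨⟨⟨φ, χ⟩, h⟩, rfl⟩ := Quotient.exists_rep a
  exact ⟨φ, χ, h, rfl⟩

theorem act_congr {φ ψ : SemI σ} {χ ω : Char σ} (h : χ.1 φ.dom = true) (k : ω.1 ψ.dom = true)
    (e : χ = ω) (A : Cos σ) (hA : χ.1 A = true) (hA' : ∀ a ∈ A.1, φ.1 a = ψ.1 a) :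
    χ.act φ h = ω.act ψ k := by
  subst e
  apply Subtype.ext
  funext B
  refine χ.congr hA ?_
  ext a
  constructor
  · rintro ⟨⟨b, hb, hB⟩, ha⟩
    exact ⟨⟨b, (hA' a ha) ▸ hb, hB⟩, ha⟩
  · rintro ⟨⟨b, hb, hB⟩, ha⟩
    exact ⟨⟨b, (hA' a ha).symm ▸ hb, hB⟩, ha⟩

/-- The source of `[φ, χ]` is `χ`. -/
def Germ.src : Germ σ → Char σ :=
  Quotient.lift (fun p : PreGerm σ => p.1.2) (fun _ _ h => h.1)

/-- The range of `[φ, χ]` is `φ.χ`. -/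
def Germ.rng : Germ σ → Char σ :=
  Quotient.lift (fun p : PreGerm σ => p.1.2.act p.1.1 p.2)
    (fun p q ⟨e, A, hA, hA'⟩ => act_congr p.2 q.2 e A hA hA')

theorem one_dom (χ : Char σ) : χ.1 (SemI.one σ).dom = true := by
  obtain ⟨A, hA⟩ := χ.2.1
  exact χ.mono (fun a _ => ⟨a, SemI.mem_one.2 rfl⟩) hA

theorem mul_dom {φ ψ : SemI σ} {χ : Char σ} (h : χ.1 ψ.dom = true)
    (k : (χ.act ψ h).1 φ.dom = true) : χ.1 (φ.mul ψ).dom = true := by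
  refine χ.mono (A := ψ.preim φ.dom) ?_ k
  rintro a ⟨b, hb, c, hc⟩
  exact ⟨c, (PEquiv.mem_trans _ _ _ _).2 ⟨b, hb, hc⟩⟩

theorem inv_dom {φ : SemI σ} {χ : Char σ} (h : χ.1 φ.dom = true) :
    (χ.act φ h).1 φ.inv.dom = true := by
  refine χ.mono (A := φ.dom) ?_ h
  rintro a ⟨b, hb⟩
  exact ⟨b, hb, a, (PEquiv.mem_iff_mem φ.1).2 hb⟩

theorem act_one (χ : Char σ) : χ.act (SemI.one σ) (one_dom χ) = χ := by
  apply Subtype.ext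
  funext A
  change χ.1 ((SemI.one σ).preim A) = χ.1 A
  refine congrArg χ.1 (Subtype.ext ?_)
  ext a
  constructor
  · rintro ⟨b, hb, hA⟩
    rw [SemI.mem_one] at hb
    exact hb ▸ hA
  · intro hA
    exact ⟨a, SemI.mem_one.2 rfl, hA⟩

theorem act_mul {φ ψ : SemI σ} {χ : Char σ} (h : χ.1 ψ.dom = true)
    (k : (χ.act ψ h).1 φ.dom = true) :
    χ.act (φ.mul ψ) (mul_dom h k) = (χ.act ψ h).act φ k := by
  apply Subtype.ext
  funext A
  change χ.1 ((φ.mul ψ).preim A) = χ.1 (ψ.preim (φ.preim A))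
  refine congrArg χ.1 (Subtype.ext ?_)
  ext a
  constructor
  · rintro ⟨b, hb, hA⟩
    obtain ⟨c, hc, hb⟩ := (PEquiv.mem_trans _ _ _ _).1 hb
    exact ⟨c, hc, b, hb, hA⟩
  · rintro ⟨c, hc, b, hb, hA⟩
    exact ⟨b, (PEquiv.mem_trans _ _ _ _).2 ⟨c, hc, hb⟩, hA⟩

theorem mem_inv_mul {φ : SemI σ} {a : G} (ha : a ∈ φ.dom.1) : a ∈ (φ.inv.mul φ).1 a := by
  obtain ⟨b, hb⟩ := ha
  exact (PEquiv.mem_trans _ _ _ _).2 ⟨b, hb, (PEquiv.mem_iff_mem φ.1).2 hb⟩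

theorem inv_mul_eq_one {φ : SemI σ} {a : G} (ha : a ∈ φ.dom.1) :
    (φ.inv.mul φ).1 a = (SemI.one σ).1 a :=
  (mem_inv_mul ha).trans (SemI.mem_one.2 rfl : a ∈ (SemI.one σ).1 a).symm

theorem act_inv {φ : SemI σ} {χ : Char σ} (h : χ.1 φ.dom = true) :
    (χ.act φ h).act φ.inv (inv_dom h) = χ := by
  rw [← act_mul h (inv_dom h)]
  refine Eq.trans ?_ (act_one χ)
  exact act_congr _ _ rfl φ.dom h (fun a ha => inv_mul_eq_one ha)

/-- The unit germ at `χ`. -/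
def Germ.unit (χ : Char σ) : Germ σ := Germ.mk (SemI.one σ) χ (one_dom χ)

/-- `[φ, χ]⁻¹ = [φ⁻¹, φ.χ]`. -/
def Germ.inv : Germ σ → Germ σ :=
  Quotient.lift (fun p : PreGerm σ => Germ.mk p.1.1.inv (p.1.2.act p.1.1 p.2) (inv_dom p.2))
    (by
      rintro p q ⟨e, A, hA, hA'⟩
      refine Germ.mk_eq (act_congr p.2 q.2 e A hA hA') (p.1.1.inv.preim (A.inter p.1.1.dom)) ?_ ?_
      · refine p.1.2.mono (A := A.inter p.1.1.dom) ?_ ((Char.inter_iff _ _ _).2 ⟨hA, p.2⟩)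
        rintro a ⟨ha, b, hb⟩
        exact ⟨b, hb, a, (PEquiv.mem_iff_mem p.1.1.1).2 hb, ha, b, hb⟩
      · rintro b ⟨a, hab, ha, -⟩
        have h1 : b ∈ p.1.1.1 a := (PEquiv.mem_iff_mem p.1.1.1).1 hab
        have h2 : b ∈ q.1.1.1 a := (hA' a ha) ▸ h1
        have h3 : a ∈ q.1.1.1.symm b := (PEquiv.mem_iff_mem q.1.1.1).2 h2
        exact Eq.trans hab h3.symm)

theorem germ_mul_aux (a b : Germ σ) (h : a.src = b.rng) :
    ∃ c : Germ σ, ∀ (φ ψ : SemI σ) (χ : Char σ) (hψ : χ.1 ψ.dom = true)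
      (hφ : (χ.act ψ hψ).1 φ.dom = true), a = Germ.mk φ (χ.act ψ hψ) hφ → b = Germ.mk ψ χ hψ →
      c = Germ.mk (φ.mul ψ) χ (mul_dom hψ hφ) := by
  obtain ⟨φ, ω, hφ, rfl⟩ := a.exists_rep
  obtain ⟨ψ, χ, hψ, rfl⟩ := b.exists_rep
  have h' : ω = χ.act ψ hψ := h
  subst h'
  refine ⟨Germ.mk (φ.mul ψ) χ (mul_dom hψ hφ), ?_⟩
  intro φ' ψ' χ' hψ' hφ' e1 e2
  obtain ⟨-, A, hA, hA'⟩ := Germ.exact e1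
  obtain ⟨e, B, hB, hB'⟩ := Germ.exact e2
  refine Germ.mk_eq e (B.inter (ψ.preim A)) ((Char.inter_iff _ _ _).2 ⟨hB, hA⟩) ?_
  rintro x ⟨hx, y, hy, hyA⟩
  have hy' : y ∈ ψ'.1 x := (hB' x hx) ▸ hy
  change (ψ.1 x).bind φ.1 = (ψ'.1 x).bind φ'.1
  rw [Option.mem_def] at hy hy'
  rw [hy, hy']
  exact hA' y hyA

/-- The product of composable germs, determined by `[φ, ψ.χ][ψ, χ] = [φψ, χ]`
(see `Germ.mul_mk`). -/
noncomputable def Germ.mul (a b : Germ σ) (h : a.src = b.rng) : Germ σ :=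
  Classical.choose (germ_mul_aux a b h)

theorem Germ.mul_mk {φ ψ : SemI σ} {χ : Char σ} (hψ : χ.1 ψ.dom = true)
    (hφ : (χ.act ψ hψ).1 φ.dom = true)
    (h : (Germ.mk φ (χ.act ψ hψ) hφ).src = (Germ.mk ψ χ hψ).rng) :
    Germ.mul (Germ.mk φ (χ.act ψ hψ) hφ) (Germ.mk ψ χ hψ) h
      = Germ.mk (φ.mul ψ) χ (mul_dom hψ hφ) :=
  Classical.choose_spec (germ_mul_aux _ _ h) φ ψ χ hψ hφ rfl rfl

theorem Germ.exists_rep₂ {a b : Germ σ} (h : a.src = b.rng) :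
    ∃ (φ ψ : SemI σ) (χ : Char σ) (hψ : χ.1 ψ.dom = true) (hφ : (χ.act ψ hψ).1 φ.dom = true),
      a = Germ.mk φ (χ.act ψ hψ) hφ ∧ b = Germ.mk ψ χ hψ := by
  obtain ⟨φ, ω, hφ, rfl⟩ := a.exists_rep
  obtain ⟨ψ, χ, hψ, rfl⟩ := b.exists_rep
  have h' : ω = χ.act ψ hψ := h
  subst h'
  exact ⟨φ, ψ, χ, hψ, hφ, rfl, rfl⟩

/-- The basic open sets `Ê(A; f)` of the character space. -/
def basicChars (A : Cos σ) (f : Finset (Cos σ)) : Set (Char σ) :=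
  {χ | χ.1 A = true ∧ ∀ B ∈ f, χ.1 B = false}

/-- The set `[φ, V]` of all germs `[φ, χ]` with `χ ∈ V`. -/
def germSet (φ : SemI σ) (V : Set (Char σ)) : Set (Germ σ) :=
  {γ | ∃ (χ : Char σ) (h : χ.1 φ.dom = true), χ ∈ V ∧ γ = Germ.mk φ χ h}

/-- The topology with basis the sets `[φ, Ê(A; f)]` with `Ê(A; f) ⊆ Ê(dom φ)`. -/
instance : TopologicalSpace (Germ σ) :=
  TopologicalSpace.generateFrom
    {W | ∃ (φ : SemI σ) (A : Cos σ) (f : Finset (Cos σ)),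
      (∀ χ ∈ basicChars A f, χ.1 φ.dom = true) ∧ W = germSet φ (basicChars A f)}

theorem Germ.src_mul (a b : Germ σ) (h : a.src = b.rng) : (a.mul b h).src = b.src := by
  obtain ⟨φ, ψ, χ, hψ, hφ, rfl, rfl⟩ := Germ.exists_rep₂ h
  rw [Germ.mul_mk]; rfl

theorem Germ.rng_mul (a b : Germ σ) (h : a.src = b.rng) : (a.mul b h).rng = a.rng := by
  obtain ⟨φ, ψ, χ, hψ, hφ, rfl, rfl⟩ := Germ.exists_rep₂ h
  rw [Germ.mul_mk]
  exact act_mul hψ hφ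

theorem Germ.mul_eq {a b : Germ σ} {h : a.src = b.rng} {φ ψ : SemI σ} {χ : Char σ}
    (hψ : χ.1 ψ.dom = true) (hφ : (χ.act ψ hψ).1 φ.dom = true)
    (ha : a = Germ.mk φ (χ.act ψ hψ) hφ) (hb : b = Germ.mk ψ χ hψ) :
    a.mul b h = Germ.mk (φ.mul ψ) χ (mul_dom hψ hφ) := by
  subst ha hb
  exact Germ.mul_mk _ _ _

theorem Germ.mk_congr {φ : SemI σ} {χ ω : Char σ} {h : χ.1 φ.dom = true} (e : χ = ω) :
    Germ.mk φ χ h = Germ.mk φ ω (e ▸ h) := by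
  subst e; rfl

variable (σ) in
/-- The transformation groupoid `I ⋉ Ê`. -/
noncomputable def transformationGroupoid : TopGroupoid (Char σ) where
  Arrow := Germ σ
  top := inferInstance
  src := Germ.src
  rng := Germ.rng
  unit := Germ.unit
  inv := Germ.inv
  mul := Germ.mul
  src_unit _ := rfl
  rng_unit χ := act_one χ
  src_inv a := by
    obtain ⟨φ, χ, h, rfl⟩ := a.exists_rep
    rfl
  rng_inv a := by
    obtain ⟨φ, χ, h, rfl⟩ := a.exists_rep
    exact act_inv h
  src_mul := Germ.src_mul
  rng_mul := Germ.rng_mul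
  mul_assoc a b c h k := by
    obtain ⟨φ, ψ, ω, hψ, hφ, rfl, rfl⟩ := Germ.exists_rep₂ h
    obtain ⟨θ, χ, hθ, rfl⟩ := c.exists_rep
    have k' : ω = χ.act θ hθ := k
    subst k'
    have h1 := Germ.mul_mk hψ hφ h
    have h2 := Germ.mul_mk hθ hψ k
    have e := act_mul hθ hψ
    rw [Germ.mul_eq hθ (mul_dom hψ hφ) h1 rfl,
      Germ.mul_eq (mul_dom hθ hψ) (e.symm ▸ hφ) (Germ.mk_congr e.symm) h2]
    exact Germ.mk_eq rfl _ (mul_dom hθ (mul_dom hψ hφ))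
      (fun a _ => by simp only [SemI.mul, PEquiv.trans_assoc])
  unit_mul a := by
    obtain ⟨φ, χ, h, rfl⟩ := a.exists_rep
    refine (Germ.mul_eq h (one_dom _) rfl rfl).trans ?_
    refine Germ.mk_eq rfl _ h ?_
    rintro a ⟨b, hb⟩
    refine Eq.trans (b := some b) ?_ hb.symm
    exact (PEquiv.mem_trans _ _ _ _).2 ⟨b, hb, SemI.mem_one.2 rfl⟩
  mul_unit a := by
    obtain ⟨φ, χ, h, rfl⟩ := a.exists_rep
    refine (Germ.mul_eq (one_dom χ) ((act_one χ).symm ▸ h) (Germ.mk_congr (act_one χ).symm) rfl).trans ?_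
    refine Germ.mk_eq rfl _ h ?_
    rintro a ⟨b, hb⟩
    refine Eq.trans (b := some b) ?_ hb.symm
    exact (PEquiv.mem_trans _ _ _ _).2 ⟨a, SemI.mem_one.2 rfl, hb⟩
  inv_mul a := by
    obtain ⟨φ, χ, h, rfl⟩ := a.exists_rep
    refine (Germ.mul_eq h (inv_dom h) rfl rfl).trans ?_
    refine Germ.mk_eq rfl φ.dom h (fun a ha => inv_mul_eq_one ha)
  mul_inv a := by
    obtain ⟨φ, χ, h, rfl⟩ := a.exists_rep
    have e := act_inv h
    refine (Germ.mul_eq (inv_dom h) (e.symm ▸ h) (Germ.mk_congr e.symm) rfl).trans ?_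
    refine Germ.mk_eq rfl φ.inv.dom (inv_dom h) (fun a ha => inv_mul_eq_one (φ := φ.inv) ha)

/-- The reduction `I ⋉ 𝔛` for a set `𝔛` of characters. -/
noncomputable def reduction (X : Set (Char σ)) : TopGroupoid X :=
  (transformationGroupoid σ).restrict X

variable (σ) in
/-- The groupoid `𝒢_σ = I ⋉ ∂Ê`. -/
noncomputable def groupoid : TopGroupoid (boundary σ) := reduction (boundary σ)

end Germs

end AlgAct

/-! Part (i): if `g` lies in the normal core of `∩𝔉(ω)` for all `ω ∈ 𝔛` with `D ∈ 𝔉(ω)`, then `𝕥_g`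
fixes each such `ω` (`act_transl_eq_self`). The germs of `𝕥_g` over the nonempty open set of `ω ∈ 𝔛`
with `ω(kD) = 1` thus form an open bisection in the isotropy. If `g ≠ e`, then `𝕥_g` has no fixed
points, none of these germs is a unit, and topological freeness fails.

Part (ii): let `[φ, χ]` lie in an open bisection of isotropy arrows. Then `φ` fixes every character
of `𝔛` in some neighbourhood `Ê(A; f)` of `χ`. Translating characters around the group turns this
into a statement about points: `φ(y)` and `y` agree modulo every `C ∈ 𝔉(ω)`, for all `ω ∈ 𝔛` with `D
∈ 𝔉(ω)`, so `φ(y) = y` for `y ∈ A \ ⋃ f` (`mem_apply_self_of_forall_act_eq`). The holes `f` remain.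
Tightness of boundary characters allows shrinking `A` to a coset `yE` that misses every hole whose
subgroup has finite index relative to `E`. As `φ` preserves `x y⁻¹ z` (`MemI.heap`), its fixed
points in `yE` form a coset of a subgroup of `E`. B. H. Neumann's covering lemma removes the holes
of infinite index (`mem_apply_self_of_cover`), so `φ` is the identity on `yE` and the germ is a
unit.

For abelian `G` the cores disappear, and maximal characters through `C ∩ D` match the condition with
exactness. -/

namespace AlgAct

universe u v

/-! ### Elements of `ℰ` as cosets of constructible subgroups -/

section Cosets

variable {S : Type u} {G : Type v} [Monoid S] [Group G] {σ : AlgebraicAction S G}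

theorem mem_sigmaP {s : S} {a b : G} : b ∈ (sigmaP σ s) a ↔ σ.hom s a = b := by
  simp [sigmaP]

theorem mem_translP {g a b : G} : b ∈ translP g a ↔ g * a = b := by
  simp [translP, Equiv.toPEquiv_apply]

theorem mem_preim_sigmaP {s : S} {A : Set G} {a : G} :
    a ∈ preim (sigmaP σ s) A ↔ σ.hom s a ∈ A := by
  constructor
  · rintro ⟨b, hb, h⟩
    rwa [mem_sigmaP.1 hb]
  · exact fun h => ⟨_, mem_sigmaP.2 rfl, h⟩

theorem mem_preim_sigmaP_symm {s : S} {A : Set G} {a : G} :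
    a ∈ preim (sigmaP σ s).symm A ↔ ∃ b ∈ A, σ.hom s b = a := by
  constructor
  · rintro ⟨b, hb, h⟩
    exact ⟨b, h, mem_sigmaP.1 ((PEquiv.mem_iff_mem _).1 hb)⟩
  · rintro ⟨b, h, hb⟩
    exact ⟨b, (PEquiv.mem_iff_mem _).2 (mem_sigmaP.2 hb), h⟩

theorem mem_preim_translP {g : G} {A : Set G} {a : G} :
    a ∈ preim (translP g) A ↔ g * a ∈ A := by
  constructor
  · rintro ⟨b, hb, h⟩
    rwa [mem_translP.1 hb]
  · exact fun h => ⟨_, mem_translP.2 rfl, h⟩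

/-- Elements of `I` preserve the ternary operation `x y⁻¹ z`. -/
theorem MemI.heap {φ : G ≃. G} (hφ : MemI σ φ) :
    ∀ {x y z x' y' z' : G}, x' ∈ φ x → y' ∈ φ y → z' ∈ φ z →
      x' * y'⁻¹ * z' ∈ φ (x * y⁻¹ * z) := by
  induction hφ with
  | sigma s =>
    intro x y z x' y' z' hx hy hz
    rw [mem_sigmaP] at *
    subst hx hy hz
    simp
  | transl g =>
    intro x y z x' y' z' hx hy hz
    rw [mem_translP] at *
    subst hx hy hz
    group
  | inv _ ih =>
    intro x y z x' y' z' hx hy hz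
    rw [PEquiv.mem_iff_mem] at *
    exact ih hx hy hz
  | comp _ _ ih₁ ih₂ =>
    intro x y z x' y' z' hx hy hz
    rw [PEquiv.mem_trans] at *
    obtain ⟨a, ha, ha'⟩ := hx
    obtain ⟨b, hb, hb'⟩ := hy
    obtain ⟨c, hc, hc'⟩ := hz
    exact ⟨_, ih₂ ha hb hc, ih₁ ha' hb' hc'⟩

variable (σ) in
/-- `A` is empty or a left coset of a constructible subgroup. -/
def IsConstructibleCoset (A : Set G) : Prop :=
  ∃ C : Subgroup G, IsConstructible σ C ∧ ∀ a ∈ A, A = a • (C : Set G)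

theorem IsConstructibleCoset.preim_sigmaP (s : S) {A : Set G} (hA : IsConstructibleCoset σ A) :
    IsConstructibleCoset σ (preim (sigmaP σ s) A) := by
  obtain ⟨C, hC, h⟩ := hA
  refine ⟨_, hC.comap s, fun a ha => ?_⟩
  rw [mem_preim_sigmaP] at ha
  ext x
  rw [mem_preim_sigmaP, h _ ha, mem_leftCoset_iff, mem_leftCoset_iff, ← map_inv, ← map_mul]
  rfl

theorem IsConstructibleCoset.preim_sigmaP_symm (s : S) {A : Set G}
    (hA : IsConstructibleCoset σ A) : IsConstructibleCoset σ (preim (sigmaP σ s).symm A) := by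
  obtain ⟨C, hC, h⟩ := hA
  refine ⟨_, hC.map s, fun a ha => ?_⟩
  obtain ⟨b, hb, rfl⟩ := mem_preim_sigmaP_symm.1 ha
  ext x
  rw [mem_preim_sigmaP_symm, mem_leftCoset_iff]
  constructor
  · rintro ⟨c, hc, rfl⟩
    rw [h _ hb, mem_leftCoset_iff] at hc
    rw [← map_inv, ← map_mul]
    exact ⟨_, hc, rfl⟩
  · rintro ⟨c, hc, e⟩
    refine ⟨b * c, ?_, ?_⟩
    · rw [h _ hb, mem_leftCoset_iff]
      simpa using hc
    · rw [map_mul]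
      exact mul_eq_of_eq_inv_mul e

theorem IsConstructibleCoset.preim_translP (g : G) {A : Set G} (hA : IsConstructibleCoset σ A) :
    IsConstructibleCoset σ (preim (translP g) A) := by
  obtain ⟨C, hC, h⟩ := hA
  refine ⟨C, hC, fun a ha => ?_⟩
  rw [mem_preim_translP] at ha
  ext x
  rw [mem_preim_translP, h _ ha, mem_leftCoset_iff, mem_leftCoset_iff]
  simp [mul_assoc]

theorem translP_symm (g : G) : (translP g).symm = translP g⁻¹ := by
  ext a b
  change b ∈ (translP g).symm a ↔ b ∈ translP g⁻¹ a
  rw [PEquiv.mem_iff_mem, mem_translP, mem_translP]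
  exact ⟨fun h => by rw [← h]; simp, fun h => by rw [← h]; simp⟩

theorem preim_trans {G : Type v} (φ ψ : G ≃. G) (A : Set G) :
    preim (ψ.trans φ) A = preim ψ (preim φ A) := by
  ext a
  simp only [preim, mem_ofPred_eq, PEquiv.mem_trans]
  constructor
  · rintro ⟨c, ⟨b, hb, hc⟩, hA⟩
    exact ⟨b, hb, c, hc, hA⟩
  · rintro ⟨b, hb, c, hc, hA⟩
    exact ⟨c, ⟨b, hb, hc⟩, hA⟩

/-- Both directions are carried through one induction because the inverse constructor of `MemI`
exchanges them. -/
theorem IsConstructibleCoset.preim_and_preim_symm {φ : G ≃. G} (hφ : MemI σ φ) :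
    ∀ {A : Set G}, IsConstructibleCoset σ A →
      IsConstructibleCoset σ (preim φ A) ∧ IsConstructibleCoset σ (preim φ.symm A) := by
  induction hφ with
  | sigma s => exact fun hA => ⟨hA.preim_sigmaP s, hA.preim_sigmaP_symm s⟩
  | transl g =>
    refine fun hA => ⟨hA.preim_translP g, ?_⟩
    rw [translP_symm]
    exact hA.preim_translP _
  | inv _ ih => exact fun hA => ⟨(ih hA).2, (ih hA).1⟩
  | comp _ _ ih₁ ih₂ =>
    intro A hA
    rw [PEquiv.symm_trans_rev, preim_trans, preim_trans]
    exact ⟨(ih₂ (ih₁ hA).1).1, (ih₁ (ih₂ hA).2).2⟩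

/-- The domain of a partial bijection is its preimage of `G`, and `G` is a constructible coset. -/
theorem isConstructibleCoset_of_mem {A : Set G} (hA : A ∈ cosets σ) :
    IsConstructibleCoset σ A := by
  obtain ⟨ε, hε, -, rfl⟩ := hA
  have h : IsConstructibleCoset σ (univ : Set G) := ⟨⊤, .top, by simp⟩
  convert (IsConstructibleCoset.preim_and_preim_symm hε h).1
  ext a
  simp [dom, preim]

theorem univ_mem_cosets : (univ : Set G) ∈ cosets σ := by
  convert (SemI.one σ).dom.2
  ext a
  exact ⟨fun _ => ⟨a, SemI.mem_one.2 rfl⟩, fun _ => trivial⟩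

theorem coe_mem_cosets {C : Subgroup G} (hC : IsConstructible σ C) : (C : Set G) ∈ cosets σ := by
  induction hC with
  | top => exact univ_mem_cosets
  | map s _ ih =>
    convert preim_mem_cosets σ (MemI.inv (MemI.sigma s)) ih
    ext x
    exact mem_preim_sigmaP_symm.symm
  | comap s _ ih =>
    convert preim_mem_cosets σ (MemI.sigma s) ih
    ext x
    exact mem_preim_sigmaP.symm

/-- The coset `gC` as an element of `ℰ`. -/
def Cos.coset (g : G) (C : Subgroup G) (hC : IsConstructible σ C) : Cos σ :=
  ⟨g • (C : Set G), by
    convert preim_mem_cosets σ (MemI.transl g⁻¹) (coe_mem_cosets hC)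
    ext x
    rw [mem_preim_translP, mem_leftCoset_iff]⟩

/-- A constructible subgroup of which `A` is a left coset, unless `A` is empty. -/
noncomputable def Cos.subgroup (A : Cos σ) : Subgroup G :=
  (isConstructibleCoset_of_mem A.2).choose

theorem Cos.isConstructible_subgroup (A : Cos σ) : IsConstructible σ A.subgroup :=
  (isConstructibleCoset_of_mem A.2).choose_spec.1

theorem Cos.eq_smul (A : Cos σ) {a : G} (ha : a ∈ A.1) : A.1 = a • (A.subgroup : Set G) :=
  (isConstructibleCoset_of_mem A.2).choose_spec.2 a ha

theorem Cos.eq_coset (A : Cos σ) {a : G} (ha : a ∈ A.1) :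
    A = Cos.coset a A.subgroup A.isConstructible_subgroup :=
  Subtype.ext (A.eq_smul ha)

theorem Cos.mem_coset {g x : G} {C : Subgroup G} {hC : IsConstructible σ C} :
    x ∈ (Cos.coset g C hC).1 ↔ g⁻¹ * x ∈ C :=
  mem_leftCoset_iff g

theorem Cos.mem_coset_self (g : G) {C : Subgroup G} {hC : IsConstructible σ C} :
    g ∈ (Cos.coset g C hC).1 := by
  simp [Cos.mem_coset]

theorem Cos.coset_eq_of_mem {g x : G} {C : Subgroup G} {hC : IsConstructible σ C}
    (h : x ∈ (Cos.coset g C hC).1) : Cos.coset g C hC = Cos.coset x C hC :=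
  Subtype.ext ((leftCoset_eq_iff C).2 (Cos.mem_coset.1 h))

/-- Closure under intersection is not part of the definition of `𝒞`. It comes from products of
idempotents: `C ∩ D` lies in `ℰ`, so it is a coset of a constructible subgroup, and it contains `1`.
-/
theorem IsConstructible.inf {C D : Subgroup G} (hC : IsConstructible σ C)
    (hD : IsConstructible σ D) : IsConstructible σ (C ⊓ D) := by
  obtain ⟨E, hE, h⟩ :=
    isConstructibleCoset_of_mem (inter_mem_cosets σ (coe_mem_cosets hC) (coe_mem_cosets hD))
  have := h 1 ⟨C.one_mem, D.one_mem⟩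
  rw [one_smul] at this
  have e : C ⊓ D = E := SetLike.coe_injective this
  rwa [e]

end Cosets

/-! ### Characters, the filters `𝔉(χ)` and translation -/

section Characters

variable {S : Type u} {G : Type v} [Monoid S] [Group G] {σ : AlgebraicAction S G}

theorem Char.nonempty (χ : Char σ) {A : Cos σ} (h : χ.1 A = true) : A.1.Nonempty := by
  by_contra h0
  rw [χ.2.2.2 A (not_nonempty_iff_eq_empty.1 h0)] at h
  exact Bool.noConfusion h

theorem Char.mem_subgroupFilter {χ : Char σ} {C : Subgroup G} :
    C ∈ χ.subgroupFilter ↔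
      ∃ (hC : IsConstructible σ C) (g : G), χ.1 (Cos.coset g C hC) = true := by
  constructor
  · rintro ⟨hC, g, A, hA, h⟩
    refine ⟨hC, g, ?_⟩
    rwa [show Cos.coset g C hC = A from Subtype.ext hA.symm]
  · rintro ⟨hC, g, h⟩
    exact ⟨hC, g, _, rfl, h⟩

theorem Char.subgroup_mem_subgroupFilter {χ : Char σ} {A : Cos σ} (h : χ.1 A = true) :
    A.subgroup ∈ χ.subgroupFilter := by
  obtain ⟨a, ha⟩ := χ.nonempty h
  exact Char.mem_subgroupFilter.2 ⟨A.isConstructible_subgroup, a, A.eq_coset ha ▸ h⟩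

/-- Finitely many elements of a filter on `ℰ` contain a common element of the filter. -/
theorem Char.exists_subset (χ : Char σ) (T : Finset (Cos σ)) :
    ∃ E : Cos σ, χ.1 E = true ∧ ∀ A ∈ T, χ.1 A = true → E.1 ⊆ A.1 := by
  classical
  induction T using Finset.induction_on with
  | empty =>
    obtain ⟨E, hE⟩ := χ.2.1
    exact ⟨E, hE, by simp⟩
  | insert A T _ ih =>
    obtain ⟨E, hE, h⟩ := ih
    by_cases hA : χ.1 A = true
    · refine ⟨E.inter A, (χ.inter_iff _ _).2 ⟨hE, hA⟩, fun B hB hχ => ?_⟩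
      rcases Finset.mem_insert.1 hB with rfl | hB
      · exact inter_subset_right
      · exact inter_subset_left.trans (h B hB hχ)
    · refine ⟨E, hE, fun B hB hχ => ?_⟩
      rcases Finset.mem_insert.1 hB with rfl | hB
      · exact absurd hχ hA
      · exact h B hB hχ

/-- Finitely many members of `𝔉(χ)` have cosets in the filter with a common representative. -/
theorem Char.exists_common_representative (χ : Char σ) (T : Finset (Subgroup G)) :
    ∃ g : G, ∀ C ∈ T, C ∈ χ.subgroupFilter →
      ∀ hC : IsConstructible σ C, χ.1 (Cos.coset g C hC) = true := by
  classical
  have key : ∀ C : Subgroup G, ∃ A : Cos σ, C ∈ χ.subgroupFilter →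
      χ.1 A = true ∧ ∃ g, ∃ hC : IsConstructible σ C, A = Cos.coset g C hC := by
    intro C
    by_cases h : C ∈ χ.subgroupFilter
    · obtain ⟨hC, g, h'⟩ := Char.mem_subgroupFilter.1 h
      exact ⟨_, fun _ => ⟨h', g, hC, rfl⟩⟩
    · exact ⟨⟨univ, univ_mem_cosets⟩, fun h' => absurd h' h⟩
  choose A hA using key
  -- Any point of a filter element inside all the chosen cosets represents all of them.
  obtain ⟨E, hE, h⟩ := χ.exists_subset (T.image A)
  obtain ⟨g, hg⟩ := χ.nonempty hE
  refine ⟨g, fun C hCT hCF hC => ?_⟩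
  obtain ⟨h1, k, hC', e⟩ := hA C hCF
  have hgA := h (A C) (Finset.mem_image_of_mem A hCT) h1 hg
  rw [e] at hgA h1
  rwa [← Cos.coset_eq_of_mem hgA]

/-- Left translation as an element of `I`. -/
def SemI.transl (σ : AlgebraicAction S G) (g : G) : SemI σ := ⟨translP g, MemI.transl g⟩

theorem Char.transl_dom (χ : Char σ) (g : G) : χ.1 (SemI.transl σ g).dom = true := by
  obtain ⟨A, hA⟩ := χ.2.1
  exact χ.mono (fun a _ => ⟨g * a, mem_translP.2 rfl⟩) hA

theorem SemI.preim_transl_coset (g h : G) {C : Subgroup G} (hC : IsConstructible σ C) :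
    (SemI.transl σ g).preim (Cos.coset h C hC) = Cos.coset (g⁻¹ * h) C hC := by
  apply Subtype.ext
  ext x
  refine mem_preim_translP.trans ?_
  rw [Cos.mem_coset, Cos.mem_coset]
  simp [mul_assoc]

theorem Char.act_transl_coset (χ : Char σ) (g h : G) {C : Subgroup G}
    (hC : IsConstructible σ C) :
    (χ.act (SemI.transl σ g) (χ.transl_dom g)).1 (Cos.coset h C hC)
      = χ.1 (Cos.coset (g⁻¹ * h) C hC) :=
  congrArg χ.1 (SemI.preim_transl_coset g h hC)

theorem Char.subgroupFilter_act_transl (χ : Char σ) (g : G) :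
    (χ.act (SemI.transl σ g) (χ.transl_dom g)).subgroupFilter = χ.subgroupFilter := by
  ext C
  simp only [Char.mem_subgroupFilter, Char.act_transl_coset]
  refine exists_congr fun hC => ⟨fun ⟨h, e⟩ => ⟨_, e⟩, fun ⟨h, e⟩ => ⟨g * h, by simpa using e⟩⟩

end Characters


/-! ### Maximal characters, tightness and invariance of the boundary -/

section Boundary

variable {S : Type u} {G : Type v} [Monoid S] [Group G] {σ : AlgebraicAction S G}

theorem isOpen_setOf_eq (A : Cos σ) (b : Bool) : IsOpen {χ : Char σ | χ.1 A = b} := by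
  have hc : Continuous fun χ : Char σ => χ.1 A :=
    (continuous_apply A).comp continuous_subtype_val
  exact (isOpen_discrete ({b} : Set Bool)).preimage hc

/-- The closure of a set of characters consists of the characters that agree on each finite set
with a member of it. -/
theorem mem_closure_iff_forall_finset {M : Set (Char σ)} {χ : Char σ} :
    χ ∈ closure M ↔ ∀ T : Finset (Cos σ), ∃ ω ∈ M, ∀ A ∈ T, ω.1 A = χ.1 A := by
  constructor
  · intro h T
    have ho : IsOpen (⋂ A ∈ T, {ω : Char σ | ω.1 A = χ.1 A}) :=
      isOpen_biInter_finset fun A _ => isOpen_setOf_eq A _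
    obtain ⟨ω, hω, hM⟩ := mem_closure_iff.1 h _ ho (by simp)
    exact ⟨ω, hM, by simpa using hω⟩
  · intro h
    rw [mem_closure_iff]
    rintro _ ⟨O, hO, rfl⟩ hχ
    obtain ⟨T, u, hu, hsub⟩ := isOpen_pi_iff.1 hO χ.1 hχ
    obtain ⟨ω, hM, hω⟩ := h T
    refine ⟨ω, hsub fun A hA => ?_, hM⟩
    rw [hω A hA]
    exact (hu A hA).2

/-- An element outside a maximal filter is disjoint from some element of it. -/
theorem exists_disjoint_of_mem_maxChars {χ : Char σ} (hχ : χ ∈ maxChars σ) {B : Cos σ}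
    (hB : χ.1 B = false) : ∃ A : Cos σ, χ.1 A = true ∧ A.1 ∩ B.1 = ∅ := by
  classical
  by_contra! h
  -- The filter generated by `χ.filt` and `B`, proper because `h` makes every `A ∩ B` nonempty.
  -- Maximality then puts `B` in the filter of `χ`.
  let ω : Char σ := ⟨fun E => decide (∃ A : Cos σ, χ.1 A = true ∧ A.1 ∩ B.1 ⊆ E.1), by
    refine ⟨?_, fun E F => ?_, fun E hE => ?_⟩
    · obtain ⟨A, hA⟩ := χ.2.1
      exact ⟨A, decide_eq_true ⟨A, hA, inter_subset_left⟩⟩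
    · rw [Bool.eq_iff_iff, Bool.and_eq_true, decide_eq_true_iff, decide_eq_true_iff,
        decide_eq_true_iff]
      constructor
      · rintro ⟨A, hA, hs⟩
        exact ⟨⟨A, hA, hs.trans inter_subset_left⟩, ⟨A, hA, hs.trans inter_subset_right⟩⟩
      · rintro ⟨⟨A, hA, hs⟩, ⟨A', hA', hs'⟩⟩
        exact ⟨A.inter A', (χ.inter_iff _ _).2 ⟨hA, hA'⟩,
          fun a ha => ⟨hs ⟨ha.1.1, ha.2⟩, hs' ⟨ha.1.2, ha.2⟩⟩⟩
    · rw [decide_eq_false_iff_not]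
      rintro ⟨A, hA, hs⟩
      rw [hE, subset_empty_iff] at hs
      exact (h A hA).ne_empty hs⟩
  have e : χ.filt = ω.filt := hχ ω fun A hA => decide_eq_true ⟨A, hA, inter_subset_left⟩
  have hBω : B ∈ ω.filt := by
    obtain ⟨A, hA⟩ := χ.2.1
    exact decide_eq_true ⟨A, hA, inter_subset_right⟩
  rw [← e] at hBω
  exact Bool.noConfusion (hB.symm.trans hBω)

/-- If a maximal filter contains none of finitely many elements of `ℰ`, then it has an element
disjoint from all of them. -/
theorem exists_disjoint_finset_of_mem_maxChars {χ : Char σ} (hχ : χ ∈ maxChars σ)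
    (f : Finset (Cos σ)) (hf : ∀ B ∈ f, χ.1 B = false) :
    ∃ A : Cos σ, χ.1 A = true ∧ ∀ B ∈ f, A.1 ∩ B.1 = ∅ := by
  classical
  have key : ∀ B : Cos σ, ∃ A : Cos σ, B ∈ f → χ.1 A = true ∧ A.1 ∩ B.1 = ∅ := fun B => by
    by_cases h : B ∈ f
    · obtain ⟨A, hA⟩ := exists_disjoint_of_mem_maxChars hχ (hf B h)
      exact ⟨A, fun _ => hA⟩
    · exact ⟨B, fun h' => absurd h' h⟩
  choose A hA using key
  obtain ⟨E, hE, h⟩ := χ.exists_subset (f.image A)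
  refine ⟨E, hE, fun B hB => ?_⟩
  rw [← subset_empty_iff, ← (hA B hB).2]
  exact inter_subset_inter_left _ (h _ (Finset.mem_image_of_mem A hB) (hA B hB).1)

/-- Characters in the boundary are tight. -/
theorem exists_eq_true_of_subset_biUnion {χ : Char σ} (hχ : χ ∈ boundary σ) {A : Cos σ}
    (hA : χ.1 A = true) (f : Finset (Cos σ)) (hf : A.1 ⊆ ⋃ B ∈ f, B.1) :
    ∃ B ∈ f, χ.1 B = true := by
  classical
  by_contra! h
  -- Only the values on `A` and `f` matter, so a maximal character can replace `χ`; its filter has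
  -- an element disjoint from every member of `f`.
  obtain ⟨ω, hω, e⟩ := mem_closure_iff_forall_finset.1 hχ (insert A f)
  obtain ⟨E, hE, hd⟩ := exists_disjoint_finset_of_mem_maxChars hω f fun B hB => by
    rw [e B (Finset.mem_insert_of_mem hB)]
    simpa using h B hB
  have hEA : ω.1 (E.inter A) = true :=
    (ω.inter_iff _ _).2 ⟨hE, (e A (Finset.mem_insert_self _ _)).trans hA⟩
  obtain ⟨a, haE, haA⟩ := ω.nonempty hEA
  obtain ⟨B, hB, haB⟩ := mem_iUnion₂.1 (hf haA)
  exact (hd B hB).le ⟨haE, haB⟩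

theorem act_inv' {φ : SemI σ} {ω : Char σ} (h : ω.1 φ.inv.dom = true)
    (h' : (ω.act φ.inv h).1 φ.dom = true) : (ω.act φ.inv h).act φ h' = ω :=
  act_inv (φ := φ.inv) h

theorem Char.filt_injective : Function.Injective (Char.filt (σ := σ)) := fun _ _ h =>
  Subtype.ext (funext fun A => Bool.eq_iff_iff.2 (Set.ext_iff.1 h A))

theorem Char.act_filt_mono {χ ω : Char σ} (φ : SemI σ) (h : χ.1 φ.dom = true)
    (k : ω.1 φ.dom = true) (hs : χ.filt ⊆ ω.filt) : (χ.act φ h).filt ⊆ (ω.act φ k).filt :=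
  fun A hA => hs (show φ.preim A ∈ χ.filt from hA)

/-- A filter larger than that of `φ.χ` still contains `im φ`, so `φ⁻¹` pulls it back to a filter
larger than that of `χ`. -/
theorem act_mem_maxChars {χ : Char σ} (hχ : χ ∈ maxChars σ) (φ : SemI σ)
    (h : χ.1 φ.dom = true) : χ.act φ h ∈ maxChars σ := by
  intro ω hω
  have k : ω.1 φ.inv.dom = true := hω (inv_dom h)
  have h1 := Char.act_filt_mono φ.inv (inv_dom h) k hω
  rw [act_inv h] at h1
  have h2 : χ = ω.act φ.inv k := Char.filt_injective (hχ _ h1)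
  have h3 : (ω.act φ.inv k).1 φ.dom = true := h2 ▸ h
  have h4 : χ.act φ h = (ω.act φ.inv k).act φ h3 := by
    subst h2
    rfl
  rw [h4, act_inv' k h3]

/-- The values of `φ.χ` on a finite set are values of `χ` on a finite set, so approximation by
maximal characters is preserved. -/
theorem invariant_boundary : Invariant (boundary σ) := by
  classical
  intro φ χ h hχ
  refine mem_closure_iff_forall_finset.2 fun T => ?_
  obtain ⟨ω, hω, e⟩ := mem_closure_iff_forall_finset.1 hχ (insert φ.dom (T.image φ.preim))
  have k : ω.1 φ.dom = true := (e _ (Finset.mem_insert_self _ _)).trans h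
  exact ⟨ω.act φ k, act_mem_maxChars hω φ k, fun A hA =>
    e _ (Finset.mem_insert_of_mem (Finset.mem_image_of_mem _ hA))⟩

/-- Every nonempty element of `ℰ` belongs to a maximal filter. -/
theorem exists_mem_maxChars {A : Cos σ} (hA : A.1.Nonempty) :
    ∃ χ ∈ maxChars σ, χ.1 A = true := by
  classical
  let P : Set (Set (Cos σ)) := {F | (∀ B C, B.inter C ∈ F ↔ B ∈ F ∧ C ∈ F) ∧ ∀ B ∈ F, B.1.Nonempty}
  have hP : {B : Cos σ | A.1 ⊆ B.1} ∈ P :=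
    ⟨fun B C => subset_inter_iff, fun B hB => hA.mono hB⟩
  obtain ⟨F, hAF, hF⟩ := zorn_subset_nonempty P (fun c hc hch ⟨F₀, hF₀⟩ => by
    refine ⟨⋃₀ c, ⟨fun B C => ⟨?_, ?_⟩, ?_⟩, fun F hF => subset_sUnion_of_mem hF⟩
    · rintro ⟨F, hF, h⟩
      have := ((hc hF).1 B C).1 h
      exact ⟨⟨F, hF, this.1⟩, ⟨F, hF, this.2⟩⟩
    · rintro ⟨⟨F, hF, hB⟩, ⟨F', hF', hC⟩⟩
      rcases hch.total hF hF' with hs | hs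
      · exact ⟨F', hF', ((hc hF').1 B C).2 ⟨hs hB, hC⟩⟩
      · exact ⟨F, hF, ((hc hF).1 B C).2 ⟨hB, hs hC⟩⟩
    · rintro B ⟨F, hF, hB⟩
      exact (hc hF).2 B hB) _ hP
  have hA' : A ∈ F := hAF (show A.1 ⊆ A.1 from subset_rfl)
  let χ : Char σ := ⟨fun B => decide (B ∈ F), ⟨A, decide_eq_true hA'⟩, fun B C => by
      rw [Bool.eq_iff_iff, Bool.and_eq_true, decide_eq_true_iff, decide_eq_true_iff,
        decide_eq_true_iff]
      exact hF.1.1 B C, fun B hB => decide_eq_false fun h => (hF.1.2 B h).ne_empty hB⟩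
  have hχ : χ.filt = F := Set.ext fun B => decide_eq_true_iff
  refine ⟨χ, fun ω hω => ?_, decide_eq_true hA'⟩
  rw [hχ] at hω ⊢
  exact hF.eq_of_subset ⟨fun B C => ω.inter_iff B C, fun B hB => ω.nonempty hB⟩ hω

end Boundary


/-! ### Part (i), and from fixed characters to fixed points -/

section Freeness

variable {S : Type u} {G : Type v} [Monoid S] [Group G] {σ : AlgebraicAction S G}

theorem mem_germSet {φ : SemI σ} {χ : Char σ} {h : χ.1 φ.dom = true} {V : Set (Char σ)}
    (hχ : χ ∈ V) : Germ.mk φ χ h ∈ germSet φ V :=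
  ⟨χ, h, hχ, rfl⟩

/-- An open set of germs that contains `[φ, χ]` contains `[φ, Ê(A; f)]` for some basic
neighbourhood `Ê(A; f)` of `χ`. -/
theorem exists_basicChars_of_isOpen {O : Set (Germ σ)} (hO : IsOpen O) {φ : SemI σ} {χ : Char σ}
    {h : χ.1 φ.dom = true} (hχ : Germ.mk φ χ h ∈ O) :
    ∃ (A : Cos σ) (f : Finset (Cos σ)), A.1 ⊆ φ.dom.1 ∧ χ ∈ basicChars A f ∧
      ∀ ω ∈ basicChars A f, ∀ k : ω.1 φ.dom = true, Germ.mk φ ω k ∈ O := by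
  classical
  induction hO with
  | basic W hW =>
    obtain ⟨ψ, A, f, -, rfl⟩ := hW
    obtain ⟨χ', k, hχ', e⟩ := hχ
    obtain ⟨rfl, B, hB, hag⟩ := Germ.exact e
    refine ⟨(A.inter B).inter φ.dom, f, inter_subset_right, ⟨?_, hχ'.2⟩, ?_⟩
    · rw [χ.inter_iff, χ.inter_iff]
      exact ⟨⟨hχ'.1, hB⟩, h⟩
    · rintro ω ⟨hω, hωf⟩ l
      rw [ω.inter_iff, ω.inter_iff] at hω
      have l' : ω.1 ψ.dom = true := by
        refine ω.mono (A := B.inter φ.dom) ?_ ((ω.inter_iff _ _).2 ⟨hω.1.2, l⟩)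
        rintro a ⟨ha, b, hb⟩
        exact ⟨b, (hag a ha) ▸ hb⟩
      exact ⟨ω, l', ⟨hω.1.1, hωf⟩, Germ.mk_eq rfl B hω.1.2 hag⟩
  | univ => exact ⟨φ.dom, ∅, subset_rfl, ⟨h, by simp⟩, fun _ _ _ => trivial⟩
  | inter O₁ O₂ _ _ ih₁ ih₂ =>
    obtain ⟨A, f, hA, hχA, hs⟩ := ih₁ hχ.1
    obtain ⟨A', f', hA', hχA', hs'⟩ := ih₂ hχ.2
    refine ⟨A.inter A', f ∪ f', inter_subset_left.trans hA,
      ⟨(χ.inter_iff _ _).2 ⟨hχA.1, hχA'.1⟩, ?_⟩, ?_⟩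
    · intro B hB
      exact (Finset.mem_union.1 hB).elim (hχA.2 B) (hχA'.2 B)
    · rintro ω ⟨hω, hωf⟩ k
      rw [ω.inter_iff] at hω
      exact ⟨hs ω ⟨hω.1, fun B hB => hωf B (Finset.mem_union_left _ hB)⟩ k,
        hs' ω ⟨hω.2, fun B hB => hωf B (Finset.mem_union_right _ hB)⟩ k⟩
  | sUnion T _ ih =>
    obtain ⟨O, hO, hχO⟩ := hχ
    obtain ⟨A, f, hA, hχA, hs⟩ := ih O hO hχO
    exact ⟨A, f, hA, hχA, fun ω hω k => ⟨O, hO, hs ω hω k⟩⟩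

/-- Translation by an element of the normal core of `∩𝔉(χ)` fixes `χ`. -/
theorem act_transl_eq_self {χ : Char σ} {g : G} (hg : g ∈ (sInf χ.subgroupFilter).normalCore) :
    χ.act (SemI.transl σ g) (χ.transl_dom g) = χ := by
  -- For `C ∈ 𝔉(χ)` all conjugates of `g` lie in `C`, so `g` fixes every coset `hC`. For other `C`,
  -- `χ` vanishes on all cosets, so nothing needs to be fixed.
  have key : ∀ (h : G) (C : Subgroup G) (hC : IsConstructible σ C), C ∈ χ.subgroupFilter →
      Cos.coset (g⁻¹ * h) C hC = Cos.coset h C hC := by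
    intro h C hC hCF
    have h1 : h⁻¹ * g * h ∈ C := by
      have := hg h⁻¹
      rw [inv_inv] at this
      exact Subgroup.mem_sInf.1 this C hCF
    refine Cos.coset_eq_of_mem (Cos.mem_coset.2 ?_)
    simpa [mul_assoc] using h1
  refine Subtype.ext (funext fun A => ?_)
  rcases A.1.eq_empty_or_nonempty with hA | ⟨a, ha⟩
  · rw [χ.2.2.2 A hA, (χ.act _ _).2.2.2 A hA]
  · rw [A.eq_coset ha, Char.act_transl_coset]
    by_cases hF : A.subgroup ∈ χ.subgroupFilter
    · rw [key a _ _ hF]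
    · have : ∀ b, χ.1 (Cos.coset b A.subgroup A.isConstructible_subgroup) = false := fun b =>
        Bool.eq_false_iff.2 fun hb => hF (Char.mem_subgroupFilter.2 ⟨_, b, hb⟩)
      rw [this, this]

/-- A nontrivial `g` in the intersection would make the germs of `𝕥_g` over the open set `{ω ∈ X :
ω(kD) = 1}` a bisection `U` of non-unit isotropy arrows lying over that whole set. -/
theorem iInf_normalCore_eq_bot_of_topologicallyFree {X : Set (Char σ)}
    (h : (reduction X).TopologicallyFree) {D : Subgroup G} (hD : D ∈ ⋃₀ filterFamily X) :
    (⨅ F ∈ {F ∈ filterFamily X | D ∈ F}, (sInf F).normalCore) = ⊥ := by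
  rw [eq_bot_iff]
  intro g hg
  rw [Subgroup.mem_bot]
  by_contra hne
  obtain ⟨_, ⟨χ, hχX, rfl⟩, hDχ⟩ := hD
  obtain ⟨hC, k, hk⟩ := Char.mem_subgroupFilter.1 hDχ
  let A : Cos σ := Cos.coset k D hC
  have hfix : ∀ ω ∈ X, ω.1 A = true → ω.act (SemI.transl σ g) (ω.transl_dom g) = ω := by
    intro ω hω hωA
    refine act_transl_eq_self ?_
    have := Subgroup.mem_iInf.1 hg ω.subgroupFilter
    exact Subgroup.mem_iInf.1 this
      ⟨⟨ω, hω, rfl⟩, Char.mem_subgroupFilter.2 ⟨hC, k, hωA⟩⟩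
  let W : Set (Germ σ) := germSet (SemI.transl σ g) (basicChars A ∅)
  let U : Set (reduction X).Arrow := {a | a.1 ∈ W}
  have hW : ∀ a ∈ U, ∃ ω : X, ω.1.1 A = true ∧
      a.1 = Germ.mk (SemI.transl σ g) ω.1 (ω.1.transl_dom g) ∧
      (reduction X).src a = ω ∧ (reduction X).rng a = ω := by
    rintro ⟨a, hs, hr⟩ ⟨ω, l, hω, e⟩
    change a = _ at e
    subst e
    exact ⟨⟨ω, hs⟩, hω.1, rfl, rfl, Subtype.ext (hfix ω hs hω.1)⟩
  have hU : (reduction X).IsOpenBisection U := by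
    refine ⟨?_, ?_, ?_⟩
    · have hWo : IsOpen W := TopologicalSpace.isOpen_generateFrom_of_mem
        ⟨SemI.transl σ g, A, ∅, fun ω _ => ω.transl_dom g, rfl⟩
      exact hWo.preimage continuous_subtype_val
    · intro a ha b hb e
      obtain ⟨ω, -, e1, e2, -⟩ := hW a ha
      obtain ⟨ω', -, e1', e2', -⟩ := hW b hb
      rw [e2, e2'] at e
      subst e
      exact Subtype.ext (e1.trans e1'.symm)
    · intro a ha b hb e
      obtain ⟨ω, -, e1, -, e2⟩ := hW a ha
      obtain ⟨ω', -, e1', -, e2'⟩ := hW b hb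
      rw [e2, e2'] at e
      subst e
      exact Subtype.ext (e1.trans e1'.symm)
  have hiso : U ⊆ (reduction X).iso \ range (reduction X).unit := by
    intro a ha
    obtain ⟨ω, -, e, hs, hr⟩ := hW a ha
    refine ⟨hs.trans hr.symm, ?_⟩
    rintro ⟨ω', rfl⟩
    have e' : Germ.mk (SemI.one σ) ω'.1 (one_dom ω'.1) = _ := e
    obtain ⟨-, B, hB, hag⟩ := Germ.exact e'
    -- A unit germ would force `g * b = b` at some point `b`.
    obtain ⟨b, hb⟩ := ω'.1.nonempty hB
    have h1 : b ∈ (SemI.transl σ g).1 b := (hag b hb).symm.trans (SemI.mem_one.2 rfl)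
    exact hne (by simpa using mem_translP.1 h1)
  have hint := h U hU hiso
  have hsub : {ω : X | ω.1.1 A = true} ⊆
      {x : X | ∃ a ∈ U, (reduction X).src a = x ∧ (reduction X).rng a = x} := by
    intro ω hω
    have hr : (Germ.mk (SemI.transl σ g) ω.1 (ω.1.transl_dom g)).rng = ω.1 := hfix ω.1 ω.2 hω
    refine ⟨⟨Germ.mk (SemI.transl σ g) ω.1 (ω.1.transl_dom g), ω.2, ?_⟩,
      mem_germSet ⟨hω, by simp⟩, rfl, Subtype.ext hr⟩
    exact (congrArg (· ∈ X) hr).mpr ω.2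
  have hop : IsOpen {ω : X | ω.1.1 A = true} :=
    (isOpen_setOf_eq A true).preimage continuous_subtype_val
  have : (⟨χ, hχX⟩ : X) ∈ interior
      {x : X | ∃ a ∈ U, (reduction X).src a = x ∧ (reduction X).rng a = x} :=
    interior_maximal hsub hop hk
  rw [hint] at this
  exact this

/-- For `y ∈ A \ ⋃ f` with `A` a coset of `D`, a character with `D ∈ 𝔉(ω)` has a translate in
`Ê(A; f)` that takes the value `1` on `yC`, for any given `C ∈ 𝔉(ω)`. -/
theorem exists_translate_mem_basicChars {X : Set (Char σ)} (hX : Invariant X) {ω : Char σ}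
    (hω : ω ∈ X) {D C : Subgroup G} (hD : IsConstructible σ D) (hC : IsConstructible σ C)
    (hDF : D ∈ ω.subgroupFilter) (hCF : C ∈ ω.subgroupFilter) {f : Finset (Cos σ)} {y : G}
    (hy : ∀ B ∈ f, y ∉ B.1) :
    ∃ ω' ∈ X, ω'.subgroupFilter = ω.subgroupFilter ∧ ω' ∈ basicChars (Cos.coset y D hD) f ∧
      ω'.1 (Cos.coset y C hC) = true := by
  classical
  obtain ⟨h, hh⟩ := ω.exists_common_representative (insert C (insert D (f.image Cos.subgroup)))
  -- Translation by `x` carries the common representative `h` to `y`.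
  let x : G := y * h⁻¹
  have hF := ω.subgroupFilter_act_transl x
  have key : ∀ E ∈ insert C (insert D (f.image Cos.subgroup)), E ∈ ω.subgroupFilter →
      ∀ hE : IsConstructible σ E,
        (ω.act (SemI.transl σ x) (ω.transl_dom x)).1 (Cos.coset y E hE) = true := by
    intro E hE hEF hEc
    rw [Char.act_transl_coset]
    simpa [x] using hh E hE hEF hEc
  refine ⟨ω.act (SemI.transl σ x) (ω.transl_dom x), hX _ _ _ hω, hF,
    ⟨key D (by simp) hDF hD, fun B hB => ?_⟩, key C (by simp) hCF hC⟩
  rw [Bool.eq_false_iff]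
  intro hBt
  have hBF := Char.subgroup_mem_subgroupFilter hBt
  rw [hF] at hBF
  -- If the translate were `1` on `B`, it would also be `1` on the coset of `B.subgroup` through
  -- `y`. The two cosets would meet, hence coincide, and `y` would lie in `B`.
  have hyB := key B.subgroup (by
    simp only [Finset.mem_insert, Finset.mem_image]
    exact Or.inr (Or.inr ⟨B, hB, rfl⟩)) hBF B.isConstructible_subgroup
  obtain ⟨z, hz, hzB⟩ := Char.nonempty _ ((Char.inter_iff _ _ _).2 ⟨hyB, hBt⟩)
  have e : B = Cos.coset y B.subgroup B.isConstructible_subgroup :=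
    (B.eq_coset hzB).trans (Cos.coset_eq_of_mem hz).symm
  refine hy B hB ?_
  rw [e]
  exact Cos.mem_coset_self y

/-- If `φ` fixes all characters in `𝔛 ∩ Ê(A; f)`, where `A` is a coset of `D`, then it fixes all
points of `A \ ⋃ f`. -/
theorem mem_apply_self_of_forall_act_eq {X : Set (Char σ)} (hX : Invariant X) {D : Subgroup G}
    (hD : IsConstructible σ D)
    (hbot : (⨅ F ∈ {F ∈ filterFamily X | D ∈ F}, sInf F) = ⊥) {φ : SemI σ} {f : Finset (Cos σ)}
    {y : G} (hy : ∀ B ∈ f, y ∉ B.1)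
    (hfix : ∀ ω ∈ X, ω ∈ basicChars (Cos.coset y D hD) f →
      ∃ k : ω.1 φ.dom = true, ω.act φ k = ω)
    (hdom : y ∈ φ.dom.1) : y ∈ φ.1 y := by
  obtain ⟨v, hv⟩ := hdom
  suffices h : y⁻¹ * v = 1 by
    rw [_root_.inv_mul_eq_one] at h
    rwa [← h] at hv
  rw [← Subgroup.mem_bot, ← hbot]
  refine Subgroup.mem_iInf.2 fun F => Subgroup.mem_iInf.2 ?_
  rintro ⟨⟨ω, hω, rfl⟩, hDF⟩
  refine Subgroup.mem_sInf.2 fun C hCF => ?_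
  have hC := hCF.1
  have hpre : ∀ ω ∈ X, ω ∈ basicChars (Cos.coset y D hD) f → ∀ B : Cos σ, ω.1 B = true →
      ω.1 (B.inter (φ.preim B)) = true := by
    intro ω hω hωb B hB
    obtain ⟨k, e⟩ := hfix ω hω hωb
    refine (ω.inter_iff _ _).2 ⟨hB, ?_⟩
    have h1 : (ω.act φ k).1 B = true := e.symm ▸ hB
    exact h1
  -- The first translate is `1` on `yC`, hence on `A = yC ∩ φ⁻¹(yC)`. So `φ` maps a coset of
  -- `A.subgroup ≤ C` into `yC`, but `y` itself need not lie in `A`.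
  obtain ⟨ω', hω', hF', hb', hC'⟩ := exists_translate_mem_basicChars hX hω hD hC hDF hCF hy
  have hA := hpre ω' hω' hb' _ hC'
  set A := (Cos.coset y C hC).inter (φ.preim (Cos.coset y C hC)) with hAdef
  have hAF := Char.subgroup_mem_subgroupFilter hA
  obtain ⟨z, hz⟩ := ω'.nonempty hA
  obtain ⟨w, hzw, hw⟩ := hz.2
  -- The second translate recentres at `y`: some `p` and `q = φ(p)` both lie in `y • A.subgroup`.
  obtain ⟨ω₂, hω₂, -, hb₂, hC₂⟩ := exists_translate_mem_basicChars hX hω' hD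
    A.isConstructible_subgroup (hF'.symm ▸ hDF) hAF hy
  obtain ⟨p, hp, q, hpq, hq⟩ := ω₂.nonempty (hpre ω₂ hω₂ hb₂ _ hC₂)
  have hmem : ∀ c ∈ A.subgroup, z * c ∈ A.1 := fun c hc => by
    rw [A.eq_smul hz, mem_leftCoset_iff]
    simpa using hc
  have hsub : ∀ c ∈ A.subgroup, c ∈ C := fun c hc => by
    have h1 := Cos.mem_coset.1 (hmem c hc).1
    have h2 := Cos.mem_coset.1 hz.1
    have := C.mul_mem (C.inv_mem h2) h1
    simpa [mul_assoc] using this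
  rw [Cos.mem_coset] at hp hq hw
  obtain ⟨w', hw', hw'C⟩ := (hmem _ hp).2
  have hw'C := Cos.mem_coset.1 hw'C
  -- With `w = φ(z)` and `w' = φ(z y⁻¹ p)`, both in `yC`, the heap identity gives `q = v w⁻¹ w'`,
  -- which forces `y⁻¹ v ∈ C`.
  have h1 := MemI.heap φ.2 hv hzw hw'
  have e : y * z⁻¹ * (z * (y⁻¹ * p)) = p := by group
  rw [e] at h1
  have e' : q = v * w⁻¹ * w' := Option.mem_unique hpq h1
  have h2 : w⁻¹ * w' ∈ C := by
    have := C.mul_mem (C.inv_mem hw) hw'C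
    simpa [mul_assoc] using this
  have h3 : y⁻¹ * v = (y⁻¹ * q) * (w⁻¹ * w')⁻¹ := by rw [e']; group
  rw [h3]
  exact C.mul_mem (hsub _ hq) (C.inv_mem h2)

end Freeness


/-! ### Neumann's covering lemma -/

section Covering

/-- If a subgroup `K` and finitely many subsets of left cosets of subgroups of infinite index cover
a group, then `K` is the whole group. -/
theorem eq_top_of_cover {H : Type*} [Group H] {ι : Type*} (f : Finset ι) (K : Subgroup H)
    (L : ι → Subgroup H) (hL : ∀ i ∈ f, ¬ (L i).FiniteIndex) (B : ι → Set H)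
    (hB : ∀ i ∈ f, ∀ b ∈ B i, B i ⊆ b • (L i : Set H)) (hcov : ∀ h, h ∈ K ∨ ∃ i ∈ f, h ∈ B i) :
    K = ⊤ := by
  classical
  have hg : ∀ i, ∃ g : H, i ∈ f → B i ⊆ g • (L i : Set H) := fun i => by
    by_cases h : (B i).Nonempty ∧ i ∈ f
    · obtain ⟨⟨b, hb⟩, hi⟩ := h
      exact ⟨b, fun _ => hB i hi b hb⟩
    · refine ⟨1, fun hi b hb => absurd ⟨⟨b, hb⟩, hi⟩ h⟩
  choose g hg using hg
  let M : Option ι → Subgroup H := fun o => o.elim K L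
  let k : Option ι → H := fun o => o.elim 1 g
  have hcov' : ⋃ o ∈ Finset.insertNone f, k o • (M o : Set H) = univ := by
    refine eq_univ_of_forall fun h => mem_iUnion₂.2 ?_
    rcases hcov h with hK | ⟨i, hi, hb⟩
    · exact ⟨none, by simp, by simpa [k, M] using hK⟩
    · exact ⟨some i, by simpa using hi, hg i hi hb⟩
  -- By Neumann's lemma the cosets of infinite index can be dropped from a finite cover, which
  -- leaves at most `K`.
  have hfin := Subgroup.leftCoset_cover_filter_FiniteIndex hcov'
  refine eq_top_iff.2 fun h _ => ?_
  have hh : h ∈ ⋃ o ∈ (Finset.insertNone f).filter (fun o => (M o).FiniteIndex),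
      k o • (M o : Set H) := hfin ▸ mem_univ h
  obtain ⟨o, ho, hm⟩ := mem_iUnion₂.1 hh
  rw [Finset.mem_filter] at ho
  cases o with
  | none => simpa [k, M] using hm
  | some i => exact absurd ho.2 (hL i (by simpa using ho.1))

end Covering

/-! ### Part (ii): removing the holes -/

section Freeness

variable {S : Type u} {G : Type v} [Monoid S] [Group G] {σ : AlgebraicAction S G}

/-- A constructible subgroup of finite index in `D` that is contained in all those of finitely many
constructible subgroups that have finite relative index in `D`. -/
theorem exists_le_of_relIndex_ne_zero (f : Finset (Cos σ)) {D : Subgroup G}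
    (hD : IsConstructible σ D) :
    ∃ E : Subgroup G, IsConstructible σ E ∧ E ≤ D ∧ E.relIndex D ≠ 0 ∧
      ∀ B ∈ f, B.subgroup.relIndex D ≠ 0 → E ≤ B.subgroup := by
  classical
  induction f using Finset.induction_on with
  | empty => exact ⟨D, hD, le_rfl, by simp, by simp⟩
  | insert B f _ ih =>
    obtain ⟨E, hE, hED, hi, h⟩ := ih
    by_cases hB : B.subgroup.relIndex D = 0
    · refine ⟨E, hE, hED, hi, fun B' hB' hne => ?_⟩
      rcases Finset.mem_insert.1 hB' with rfl | hB'
      · exact absurd hB hne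
      · exact h B' hB' hne
    · refine ⟨E ⊓ B.subgroup, hE.inf B.isConstructible_subgroup, inf_le_left.trans hED,
        Subgroup.relIndex_inf_ne_zero hi hB, fun B' hB' hne => ?_⟩
      rcases Finset.mem_insert.1 hB' with rfl | hB'
      · exact inf_le_right
      · exact inf_le_left.trans (h B' hB' hne)

/-- A character in the boundary which is `1` on a coset of `D` is `1` on a smaller coset of any
constructible subgroup of finite index in `D`. -/
theorem exists_coset_of_relIndex_ne_zero {χ : Char σ} (hχ : χ ∈ boundary σ) {A : Cos σ}
    (hA : χ.1 A = true) {E : Subgroup G} (hE : IsConstructible σ E) (hED : E ≤ A.subgroup)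
    (hi : E.relIndex A.subgroup ≠ 0) :
    ∃ k ∈ A.1, (Cos.coset k E hE).1 ⊆ A.1 ∧ χ.1 (Cos.coset k E hE) = true := by
  classical
  obtain ⟨a, ha⟩ := χ.nonempty hA
  have hfin : (E.subgroupOf A.subgroup).FiniteIndex := ⟨hi⟩
  have : Fintype (A.subgroup ⧸ E.subgroupOf A.subgroup) := Fintype.ofFinite _
  let r : A.subgroup ⧸ E.subgroupOf A.subgroup → G := fun q => a * (q.out : G)
  have hr : ∀ q, r q ∈ A.1 := fun q => by
    rw [A.eq_smul ha, mem_leftCoset_iff]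
    simp [r]
  -- `A` is a union of finitely many cosets of `E`, so tightness selects one of them.
  obtain ⟨B, hB, h⟩ := exists_eq_true_of_subset_biUnion hχ hA
    (Finset.univ.image fun q => Cos.coset (r q) E hE) (by
      intro x hx
      rw [A.eq_smul ha, mem_leftCoset_iff] at hx
      let x' : A.subgroup := ⟨a⁻¹ * x, hx⟩
      refine mem_iUnion₂.2 ⟨_, Finset.mem_image_of_mem _ (Finset.mem_univ (x' : _ ⧸ _)), ?_⟩
      rw [Cos.mem_coset]
      have h1 : ((x' : A.subgroup ⧸ E.subgroupOf A.subgroup).out)⁻¹ * x' ∈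
          E.subgroupOf A.subgroup := QuotientGroup.eq.1 (QuotientGroup.out_eq' _)
      have h2 := Subgroup.mem_subgroupOf.1 h1
      simpa [r, x', mul_assoc] using h2)
  obtain ⟨q, -, rfl⟩ := Finset.mem_image.1 hB
  refine ⟨r q, hr q, fun x hx => ?_, h⟩
  rw [A.eq_smul (hr q), mem_leftCoset_iff]
  exact hED (Cos.mem_coset.1 hx)

/-- If `φ` fixes the points of a coset `yE` outside finitely many cosets whose subgroups either
contain `E` and miss the coset, or have infinite index in `E`, then `φ` fixes all of `yE`, as soon
as it fixes `y`. -/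
theorem mem_apply_self_of_cover {φ : SemI σ} {E : Subgroup G} (hE : IsConstructible σ E) {y : G}
    (hy : y ∈ φ.1 y) (f : Finset (Cos σ))
    (hf : ∀ B ∈ f, B.subgroup.relIndex E ≠ 0 → Disjoint B.1 (Cos.coset y E hE).1)
    (hfix : ∀ x ∈ (Cos.coset y E hE).1, (∀ B ∈ f, x ∉ B.1) → x ∈ φ.1 x) :
    ∀ x ∈ (Cos.coset y E hE).1, x ∈ φ.1 x := by
  classical
  -- The fixed points of `φ` in `yE`, shifted by `y⁻¹`. The heap identity together with `φ(y) = y`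
  -- makes them a subgroup.
  let K : Subgroup E :=
    { carrier := {d | y * d ∈ φ.1 (y * d)}
      one_mem' := by simpa using hy
      mul_mem' := fun {a b} ha hb => by
        have := MemI.heap φ.2 ha hy hb
        have e : y * (a : G) * y⁻¹ * (y * b) = y * ((a * b : E) : G) := by
          push_cast
          group
        rwa [e] at this
      inv_mem' := fun {a} ha => by
        have := MemI.heap φ.2 hy ha hy
        have e : y * (y * (a : G))⁻¹ * y = y * ((a⁻¹ : E) : G) := by
          push_cast
          group
        rwa [e] at this }
  have hK : K = ⊤ := by
    refine eq_top_of_cover (f.filter fun B => B.subgroup.relIndex E = 0) K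
      (fun B => B.subgroup.subgroupOf E) (fun B hB h => h.index_ne_zero (Finset.mem_filter.1 hB).2)
      (fun B => {d | y * (d : G) ∈ B.1}) ?_ ?_
    · intro B _ b hb d hd
      rw [mem_leftCoset_iff]
      change y * (b : G) ∈ B.1 at hb
      change y * (d : G) ∈ B.1 at hd
      rw [B.eq_smul hb, mem_leftCoset_iff] at hd
      refine Subgroup.mem_subgroupOf.2 ?_
      simpa [mul_assoc] using hd
    · intro d
      by_cases h : ∀ B ∈ f, y * (d : G) ∉ B.1
      · exact Or.inl (hfix _ (Cos.mem_coset.2 (by simp)) h)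
      · push Not at h
        obtain ⟨B, hB, hd⟩ := h
        refine Or.inr ⟨B, Finset.mem_filter.2 ⟨hB, ?_⟩, hd⟩
        by_contra hne
        exact Set.disjoint_left.1 (hf B hB hne) hd (Cos.mem_coset.2 (by simp))
  intro x hx
  have h1 : (⟨y⁻¹ * x, Cos.mem_coset.1 hx⟩ : E) ∈ K := hK ▸ Subgroup.mem_top _
  have h2 : y * (y⁻¹ * x) ∈ φ.1 (y * (y⁻¹ * x)) := h1
  rwa [mul_inv_cancel_left] at h2

/-- Every arrow of an open bisection inside the isotropy is shown to be a unit, so `U` is in fact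
empty. -/
theorem topologicallyFree_of_iInf_sInf_eq_bot {X : Set (Char σ)} (hXb : X ⊆ boundary σ)
    (hX : Invariant X)
    (h : ∀ D ∈ ⋃₀ filterFamily X, (⨅ F ∈ {F ∈ filterFamily X | D ∈ F}, sInf F) = ⊥) :
    (reduction X).TopologicallyFree := by
  classical
  intro U hU hiso
  refine eq_empty_of_forall_notMem fun x hx => ?_
  obtain ⟨⟨a, hs, hr⟩, haU, -⟩ := interior_subset hx
  obtain ⟨O, hO, rfl⟩ := isOpen_induced_iff.1 hU.1
  obtain ⟨φ, χ, hχ, rfl⟩ := a.exists_rep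
  obtain ⟨A, f, hAdom, hχA, hsub⟩ := exists_basicChars_of_isOpen hO haU
  have hχX : χ ∈ X := hs
  have hfix : ∀ ω ∈ X, ω ∈ basicChars A f → ∃ k : ω.1 φ.dom = true, ω.act φ k = ω := by
    intro ω hω hωA
    have k : ω.1 φ.dom = true := ω.mono hAdom hωA.1
    refine ⟨k, ?_⟩
    have := (hiso (a := ⟨Germ.mk φ ω k, hω, hX φ ω k hω⟩) (hsub ω hωA k)).1
    exact (congrArg Subtype.val this).symm
  obtain ⟨E, hE, hEA, hEi, hEf⟩ := exists_le_of_relIndex_ne_zero f A.isConstructible_subgroup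
  obtain ⟨k, hkA, hkE, hk⟩ := exists_coset_of_relIndex_ne_zero (hXb hχX) hχA.1 hE hEA hEi
  -- `χ` is `1` on `kE` and `0` on `f`, so by tightness `f` cannot cover `kE`.
  have hy : ∃ y ∈ (Cos.coset k E hE).1, ∀ B ∈ f, y ∉ B.1 := by
    by_contra! hc
    obtain ⟨B, hB, h1⟩ := exists_eq_true_of_subset_biUnion (hXb hχX) hk f fun x hx => by
      obtain ⟨B, hB, hxB⟩ := hc x hx
      exact mem_iUnion₂.2 ⟨B, hB, hxB⟩
    exact Bool.noConfusion (h1.symm.trans (hχA.2 B hB))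
  obtain ⟨y, hyE, hyf⟩ := hy
  rw [Cos.coset_eq_of_mem hyE] at hkE hk
  have hpt : ∀ x ∈ (Cos.coset y E hE).1, (∀ B ∈ f, x ∉ B.1) → x ∈ φ.1 x := by
    intro x hx hxf
    refine mem_apply_self_of_forall_act_eq hX hE (h E ⟨_, ⟨χ, hχX, rfl⟩,
      Char.mem_subgroupFilter.2 ⟨hE, y, hk⟩⟩) hxf (fun ω hω hωb => hfix ω hω ⟨?_, hωb.2⟩)
      (hAdom (hkE hx))
    refine ω.mono ?_ hωb.1
    rwa [← Cos.coset_eq_of_mem hx]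
  have hall := mem_apply_self_of_cover hE (hpt y (Cos.mem_coset_self y) hyf) f (fun B hB hne => by
    -- Finite relative index in `E` passes up to `A.subgroup`, so `E` was chosen inside
    -- `B.subgroup`. If `B` met `yE` it would contain it, contradicting `χ(B) = 0`.
    have hle : E ≤ B.subgroup :=
      hEf B hB (Subgroup.relIndex_ne_zero_trans hne hEi)
    rw [Set.disjoint_left]
    intro x hxB hxE
    have hsubB : (Cos.coset y E hE).1 ⊆ B.1 := by
      rw [Cos.coset_eq_of_mem hxE, B.eq_smul hxB]
      exact smul_set_mono hle
    exact Bool.noConfusion ((χ.mono hsubB hk).symm.trans (hχA.2 B hB))) hpt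
  refine (hiso haU).2 ⟨⟨χ, hχX⟩, Subtype.ext ?_⟩
  exact Germ.mk_eq rfl (Cos.coset y E hE) hk fun b hb =>
    (SemI.mem_one.2 rfl : b ∈ (SemI.one σ).1 b).trans (hall b hb).symm

/-! ### Exactness -/

theorem Char.top_mem_subgroupFilter (χ : Char σ) : (⊤ : Subgroup G) ∈ χ.subgroupFilter := by
  obtain ⟨A, hA⟩ := χ.2.1
  refine Char.mem_subgroupFilter.2 ⟨.top, 1, χ.mono (fun a _ => ?_) hA⟩
  exact Cos.mem_coset.2 trivial

/-- Part (i) is applied with `D = ⊤`: the intersection of all constructible subgroups lies in every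
`∩𝔉(ω)`, and commutativity puts it in the core. -/
theorem exact_of_topologicallyFree (hcomm : ∀ a b : G, a * b = b * a)
    (h : (groupoid σ).TopologicallyFree) : σ.Exact := by
  obtain ⟨χ, hχ, -⟩ := exists_mem_maxChars (σ := σ) (A := (SemI.one σ).dom)
    ⟨1, 1, SemI.mem_one.2 rfl⟩
  have h1 := iInf_normalCore_eq_bot_of_topologicallyFree h
    (D := ⊤) ⟨_, ⟨χ, subset_closure hχ, rfl⟩, χ.top_mem_subgroupFilter⟩
  rw [AlgebraicAction.Exact, eq_bot_iff, ← h1]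
  intro g hg
  refine Subgroup.mem_iInf.2 fun F => Subgroup.mem_iInf.2 ?_
  rintro ⟨⟨ω, -, rfl⟩, -⟩ b
  have e : b * g * b⁻¹ = g := by rw [hcomm b g, mul_inv_cancel_right]
  rw [e]
  exact Subgroup.mem_sInf.2 fun C hC => Subgroup.mem_sInf.1 hg C hC.1

/-- For each constructible `C`, a maximal character that is `1` on `C ∩ D` has both `C` and `D` in
its `𝔉`, so the intersection over all `𝔉` containing `D` is contained in `C`. -/
theorem topologicallyFree_of_exact (h : σ.Exact) : (groupoid σ).TopologicallyFree := by
  refine topologicallyFree_of_iInf_sInf_eq_bot subset_rfl invariant_boundary ?_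
  rintro D ⟨_, ⟨χ, -, rfl⟩, hD, -⟩
  rw [AlgebraicAction.Exact] at h
  rw [eq_bot_iff, ← h]
  intro g hg
  refine Subgroup.mem_sInf.2 fun C hC => ?_
  let A : Cos σ := (Cos.coset 1 C hC).inter (Cos.coset 1 D hD)
  obtain ⟨ω, hω, hA⟩ := exists_mem_maxChars (σ := σ) (A := A)
    ⟨1, Cos.mem_coset_self 1, Cos.mem_coset_self 1⟩
  have hA' := (ω.inter_iff _ _).1 hA
  have hgω := Subgroup.mem_iInf.1 (Subgroup.mem_iInf.1 hg ω.subgroupFilter)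
    ⟨⟨ω, subset_closure hω, rfl⟩, Char.mem_subgroupFilter.2 ⟨hD, 1, hA'.2⟩⟩
  exact Subgroup.mem_sInf.1 hgω C (Char.mem_subgroupFilter.2 ⟨hC, 1, hA'.1⟩)

end Freeness

end AlgAct

theorem mainTheorem4 {S G : Type*} [Monoid S] [Group G] (σ : AlgAct.AlgebraicAction S G)
    (hfaithful : σ.Faithful) (hnonaut : σ.NonAutomorphic) :
    (∀ X : Set (AlgAct.Char σ), X ⊆ AlgAct.boundary σ → IsClosed X → AlgAct.Invariant X →
      ((AlgAct.reduction X).TopologicallyFree →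
        ∀ D ∈ ⋃₀ AlgAct.filterFamily X,
          (⨅ F ∈ {F ∈ AlgAct.filterFamily X | D ∈ F}, (sInf F).normalCore) = ⊥) ∧
      ((∀ D ∈ ⋃₀ AlgAct.filterFamily X,
          (⨅ F ∈ {F ∈ AlgAct.filterFamily X | D ∈ F}, sInf F) = ⊥) →
        (AlgAct.reduction X).TopologicallyFree)) ∧
    ((∀ a b : G, a * b = b * a) →
      ((AlgAct.groupoid σ).TopologicallyFree ↔ σ.Exact)) := by
  refine ⟨fun X hXb _ hX => ⟨fun h D hD =>
    AlgAct.iInf_normalCore_eq_bot_of_topologicallyFree h hD,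
    AlgAct.topologicallyFree_of_iInf_sInf_eq_bot hXb hX⟩, fun hcomm =>
    ⟨AlgAct.exact_of_topologicallyFree hcomm, AlgAct.topologicallyFree_of_exact⟩⟩
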